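/- Let $D\subset\mathbb{R}^2$ be a bounded open set with smooth boundary, let $h>0$ and $\Omega=D\times(-h,0)\subset\mathbb{R}^3$, with points written $(x,y,z)$. Let $\nabla=(\partial_x,\partial_y)$ and, for $v\in(L^2(\Omega))^2$, let $\overline v(x,y)=\frac1h\int_{-h}^0 v(x,y,z)\,dz$. Define $$H_1=\{v\in(L^2(\Omega))^2:\ \nabla\cdot\overline v=0 \text{ in } D,\ \ \overline v\cdot n=0\text{ on }\partial D\},$$ $$G=\{u\in(L^2(\Omega))^2:\ u_z=0,\ u=\nabla q \text{ for some } q\in H^1(D)\}.$$ Derivatives are weak derivatives, and the normal component on $\partial D$ is the weak normal trace: for $w\in(L^2(D))^2$ with $\nabla\cdot w\in L^2(D)$, $w\cdot n$ is the functional $\langle w\cdot n,\varphi\rangle=\int_D w\cdot\nabla\varphi+\int_D(\nabla\cdot w)\,\varphi$, $\varphi\in C_c^\infty(\mathbb{R}^2)$. Then $H_1$ is a closed subspace of $(L^2(\Omega))^2$, and $$(L^2(\Omega))^2=H_1\oplus G$$ as an orthogonal direct sum. Consequently there is a unique orthogonal projection $\mathbb{P}$ of $(L^2(\Omega))^2$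 onto $H_1$ (the hydrostatic Leray projector), and its kernel is $G$. -/

import Mathlib

open MeasureTheory Set
open scoped ContDiff

namespace HydrostaticHelmholtz

/-- The horizontal plane `ℝ²` with its Euclidean structure. -/
abbrev Plane : Type := EuclideanSpace ℝ (Fin 2)

/-- `D` has smooth boundary: near each boundary point, after a rotation or reflection of the
coordinates, `D` is the set of points lying strictly above the graph of a smooth function. -/
def HasSmoothBoundary (D : Set Plane) : Prop :=
  ∀ p ∈ frontier D, ∃ r : ℝ, 0 < r ∧ ∃ (A : Plane ≃ₗᵢ[ℝ] Plane) (γ : ℝ → ℝ), ContDiff ℝ ∞ γ ∧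
    ∀ x ∈ Metric.ball p r, x ∈ D ↔ γ ((A x) 0) < (A x) 1

/-- The cylinder `Ω = D × (-h, 0)`. A point of `ℝ³` is written `(x, z)` with `x` horizontal. -/
def cylinder (D : Set Plane) (h : ℝ) : Set (Plane × ℝ) := D ×ˢ Ioo (-h) 0

/-- `(L²(Ω))²`, the Hilbert space of square integrable horizontal vector fields on `Ω`. -/
abbrev L2Field (D : Set Plane) (h : ℝ) : Type :=
  Lp Plane 2 ((volume : Measure (Plane × ℝ)).restrict (cylinder D h))

/-- `φ ∈ C_c^∞(U)`: a smooth real function with compact support contained in `U`. -/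
structure IsTest {E : Type*} [NormedAddCommGroup E] [NormedSpace ℝ E]
    (U : Set E) (φ : E → ℝ) : Prop where
  smooth : ContDiff ℝ ∞ φ
  compact : HasCompactSupport φ
  supp : tsupport φ ⊆ U

/-- `w` is the weak derivative of `u` in the direction `e` on `U` (for locally integrable `u`
and `w`): `∫_U (∂_e φ) u = - ∫_U φ w` for all `φ ∈ C_c^∞(U)`. -/
def HasWeakDeriv {E F : Type*} [NormedAddCommGroup E] [NormedSpace ℝ E] [MeasureSpace E]
    [NormedAddCommGroup F] [NormedSpace ℝ F]
    (U : Set E) (e : E) (u w : E → F) : Prop :=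
  ∀ φ : E → ℝ, IsTest U φ →
    ∫ x in U, (fderiv ℝ φ x e) • u x = - ∫ x in U, φ x • w x

/-- `q ∈ H¹(D)` with weak gradient `∇q = g`: both are square integrable on `D`, and the `i`-th
component of `g` is the weak `i`-th partial derivative of `q`. -/
structure IsH1WithGradient (D : Set Plane) (q : Plane → ℝ) (g : Plane → Plane) : Prop where
  memLp : MemLp q 2 (volume.restrict D)
  memLp_grad : MemLp g 2 (volume.restrict D)
  weakDeriv : ∀ i : Fin 2,
    HasWeakDeriv D (EuclideanSpace.single i (1 : ℝ)) q (fun x => g x i)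

/-- The vertical average `v̄(x) = (1/h) ∫_{-h}^0 v(x, z) dz`. -/
noncomputable def verticalAverage (h : ℝ) (v : Plane × ℝ → Plane) (x : Plane) : Plane :=
  h⁻¹ • ∫ z in (-h)..0, v (x, z)

/-- The function `d` is the weak divergence of `v` on `D`:
`∫_D v · ∇φ = - ∫_D d φ` for all `φ ∈ C_c^∞(D)`. -/
def HasWeakDivergence (D : Set Plane) (v : Plane → Plane) (d : Plane → ℝ) : Prop :=
  ∀ φ : Plane → ℝ, IsTest D φ →
    ∫ x in D, inner ℝ (v x) (gradient φ x) = - ∫ x in D, d x * φ x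

/-- The normal trace on `∂D` of a square integrable field `v` with weak divergence `d`, as a
distribution: the pairing of `v · n` with (the restriction to `∂D` of) `φ ∈ C_c^∞(ℝ²)`,
given by the generalized Stokes formula `⟨v · n, φ⟩ = ∫_D v · ∇φ + ∫_D d φ`. For `v` smooth up to
the boundary it is the boundary integral of `(v · n) φ`. -/
noncomputable def normalTrace (D : Set Plane) (v : Plane → Plane) (d : Plane → ℝ)
    (φ : Plane → ℝ) : ℝ :=
  (∫ x in D, inner ℝ (v x) (gradient φ x)) + ∫ x in D, d x * φ x

/-- Membership in `H₁`: `∇ · v̄ = 0` in `D` and `v̄ · n = 0` on `∂D`. -/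
structure MemH1 (D : Set Plane) (h : ℝ) (v : Plane × ℝ → Plane) : Prop where
  div_eq_zero : HasWeakDivergence D (verticalAverage h v) 0
  normal_eq_zero : ∀ φ : Plane → ℝ, IsTest univ φ →
    normalTrace D (verticalAverage h v) 0 φ = 0

/-- Membership in `G`: `u_z = 0` weakly in `Ω`, and `u = ∇q` for some `q ∈ H¹(D)`. -/
structure MemG (D : Set Plane) (h : ℝ) (u : Plane × ℝ → Plane) : Prop where
  dz_eq_zero : HasWeakDeriv (cylinder D h) ((0, 1) : Plane × ℝ) u 0
  eq_grad : ∃ (q : Plane → ℝ) (g : Plane → Plane), IsH1WithGradient D q g ∧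
    ∀ᵐ p ∂((volume : Measure (Plane × ℝ)).restrict (cylinder D h)), u p = g p.1

/-! The remaining facts show that `H₁` and `G` are linear subspaces. -/

theorem restrict_cylinder (D : Set Plane) (h : ℝ) :
    (volume : Measure (Plane × ℝ)).restrict (cylinder D h) =
      (volume.restrict D).prod (volume.restrict (Ioo (-h) 0)) := by
  rw [Measure.prod_restrict]; rfl

theorem IsTest.memLp {E : Type*} [NormedAddCommGroup E] [NormedSpace ℝ E] [MeasurableSpace E]
    [BorelSpace E] [SecondCountableTopology E] {μ : Measure E} [IsFiniteMeasureOnCompacts μ]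
    {U : Set E} {φ : E → ℝ} (hφ : IsTest U φ) : MemLp φ 2 μ :=
  hφ.smooth.continuous.memLp_of_hasCompactSupport hφ.compact

theorem IsTest.memLp_fderiv {E : Type*} [NormedAddCommGroup E] [NormedSpace ℝ E]
    [MeasurableSpace E] [BorelSpace E] [SecondCountableTopology E] {μ : Measure E}
    [IsFiniteMeasureOnCompacts μ]
    {U : Set E} {φ : E → ℝ} (hφ : IsTest U φ) (e : E) :
    MemLp (fun x => fderiv ℝ φ x e) 2 μ :=
  ((hφ.smooth.continuous_fderiv (by simp)).clm_apply
    continuous_const).memLp_of_hasCompactSupport (hφ.compact.fderiv_apply ℝ e)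

theorem IsTest.memLp_gradient {U : Set Plane} {φ : Plane → ℝ} (hφ : IsTest U φ)
    {μ : Measure Plane} [IsFiniteMeasureOnCompacts μ] : MemLp (gradient φ) 2 μ := by
  have hc : Continuous (gradient φ) :=
    (InnerProductSpace.toDual ℝ Plane).symm.continuous.comp
      (hφ.smooth.continuous_fderiv (by simp))
  refine hc.memLp_of_hasCompactSupport ?_
  exact (hφ.compact.fderiv ℝ).comp_left (g := (InnerProductSpace.toDual ℝ Plane).symm) (map_zero _)

theorem integrable_smul_of_memLp {E F : Type*} [MeasurableSpace E] [NormedAddCommGroup F]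
    [NormedSpace ℝ F] {μ : Measure E} {f : E → ℝ} {u : E → F} (hf : MemLp f 2 μ)
    (hu : MemLp u 2 μ) : Integrable (fun x => f x • u x) μ :=
  memLp_one_iff_integrable.1 (hu.smul (p := 2) (q := 2) (r := 1) hf)

theorem integrable_inner_of_memLp {E : Type*} [MeasurableSpace E] {μ : Measure E}
    {u v : E → Plane} (hu : MemLp u 2 μ) (hv : MemLp v 2 μ) :
    Integrable (fun x => inner ℝ (u x) (v x)) μ := by
  refine (L2.integrable_inner (𝕜 := ℝ) (hu.toLp u) (hv.toLp v)).congr ?_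
  filter_upwards [hu.coeFn_toLp, hv.coeFn_toLp] with x h1 h2
  rw [h1, h2]

theorem HasWeakDeriv.add {E F : Type*} [NormedAddCommGroup E] [NormedSpace ℝ E] [MeasureSpace E]
    [BorelSpace E] [SecondCountableTopology E] [IsFiniteMeasureOnCompacts (volume : Measure E)]
    [NormedAddCommGroup F] [NormedSpace ℝ F] {U : Set E} {e : E} {u u' w w' : E → F}
    (hu : MemLp u 2 (volume.restrict U)) (hu' : MemLp u' 2 (volume.restrict U))
    (hw : MemLp w 2 (volume.restrict U)) (hw' : MemLp w' 2 (volume.restrict U))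
    (h : HasWeakDeriv U e u w) (h' : HasWeakDeriv U e u' w') :
    HasWeakDeriv U e (u + u') (w + w') := by
  intro φ hφ
  simp only [Pi.add_apply, smul_add]
  rw [integral_add (integrable_smul_of_memLp (hφ.memLp_fderiv e) hu)
      (integrable_smul_of_memLp (hφ.memLp_fderiv e) hu'),
    integral_add (integrable_smul_of_memLp hφ.memLp hw) (integrable_smul_of_memLp hφ.memLp hw'),
    h φ hφ, h' φ hφ]
  abel

theorem HasWeakDeriv.const_smul {E F : Type*} [NormedAddCommGroup E] [NormedSpace ℝ E]
    [MeasureSpace E] [NormedAddCommGroup F] [NormedSpace ℝ F] {U : Set E} {e : E} {u w : E → F}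
    (c : ℝ) (h : HasWeakDeriv U e u w) : HasWeakDeriv U e (c • u) (c • w) := by
  intro φ hφ
  simp only [Pi.smul_apply, smul_comm _ c]
  rw [integral_smul, integral_smul, h φ hφ, smul_neg]

theorem HasWeakDeriv.congr {E F : Type*} [NormedAddCommGroup E] [NormedSpace ℝ E]
    [MeasureSpace E] [NormedAddCommGroup F] [NormedSpace ℝ F] {U : Set E} {e : E}
    {u u' w : E → F} (hu : u =ᵐ[volume.restrict U] u') (h : HasWeakDeriv U e u w) :
    HasWeakDeriv U e u' w := by
  intro φ hφ
  rw [← h φ hφ]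
  refine integral_congr_ae ?_
  filter_upwards [hu] with x hx
  rw [hx]

theorem hasWeakDeriv_zero {E F : Type*} [NormedAddCommGroup E] [NormedSpace ℝ E]
    [MeasureSpace E] [NormedAddCommGroup F] [NormedSpace ℝ F] {U : Set E} {e : E} :
    HasWeakDeriv U e (0 : E → F) 0 := by
  intro φ _
  simp

/-- The space `G` of `z`-independent horizontal gradients. -/
noncomputable def G (D : Set Plane) (h : ℝ) : Submodule ℝ (L2Field D h) where
  carrier := {u | MemG D h u}
  zero_mem' := by
    have h0 := Lp.coeFn_zero Plane 2 ((volume : Measure (Plane × ℝ)).restrict (cylinder D h))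
    refine ⟨hasWeakDeriv_zero.congr h0.symm, 0, 0, ⟨MemLp.zero, MemLp.zero, fun i => ?_⟩, ?_⟩
    · exact hasWeakDeriv_zero
    · filter_upwards [h0] with p hp
      simpa using hp
  add_mem' := by
    rintro u v ⟨hu, q, g, hq, hug⟩ ⟨hv, q', g', hq', hvg⟩
    have h0 := Lp.coeFn_add u v
    refine ⟨?_, q + q', g + g', ⟨hq.memLp.add hq'.memLp, hq.memLp_grad.add hq'.memLp_grad,
      fun i => ?_⟩, ?_⟩
    · have := HasWeakDeriv.add (Lp.memLp u) (Lp.memLp v) MemLp.zero MemLp.zero hu hv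
      rw [add_zero] at this
      exact this.congr h0.symm
    · exact HasWeakDeriv.add hq.memLp hq'.memLp
        ((EuclideanSpace.proj (𝕜 := ℝ) i).comp_memLp' hq.memLp_grad)
        ((EuclideanSpace.proj (𝕜 := ℝ) i).comp_memLp' hq'.memLp_grad)
        (hq.weakDeriv i) (hq'.weakDeriv i)
    · filter_upwards [h0, hug, hvg] with p h1 h2 h3
      rw [h1, Pi.add_apply, h2, h3, Pi.add_apply]
  smul_mem' := by
    rintro c u ⟨hu, q, g, hq, hug⟩
    have h0 := Lp.coeFn_smul c u
    refine ⟨?_, c • q, c • g, ⟨hq.memLp.const_smul c, hq.memLp_grad.const_smul c,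
      fun i => (hq.weakDeriv i).const_smul c⟩, ?_⟩
    · have := hu.const_smul c
      rw [smul_zero] at this
      exact this.congr h0.symm
    · filter_upwards [h0, hug] with p h1 h2
      rw [h1, Pi.smul_apply, h2, Pi.smul_apply]

/-- A square integrable field on `Ω` paired with a test gradient on the plane is integrable. -/
theorem integrable_inner_gradient {D : Set Plane} {h : ℝ} (v : L2Field D h) {φ : Plane → ℝ}
    {U : Set Plane} (hφ : IsTest U φ) :
    Integrable (fun p : Plane × ℝ => inner ℝ (v p) (gradient φ p.1))
      ((volume : Measure (Plane × ℝ)).restrict (cylinder D h)) := by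
  have hg : MemLp (fun p : Plane × ℝ => gradient φ p.1) 2
      ((volume : Measure (Plane × ℝ)).restrict (cylinder D h)) := by
    rw [restrict_cylinder]
    exact (hφ.memLp_gradient (μ := volume.restrict D)).comp_fst _
  exact integrable_inner_of_memLp (Lp.memLp v) hg

/-- Almost every vertical fibre of a square integrable field is integrable. -/
theorem ae_integrable_fibre {D : Set Plane} {h : ℝ} (v : L2Field D h) :
    ∀ᵐ x ∂(volume.restrict D), Integrable (fun z => v (x, z)) (volume.restrict (Ioo (-h) 0)) := by
  have h2 : MemLp v 2 ((volume.restrict D).prod (volume.restrict (Ioo (-h) 0))) := by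
    rw [← restrict_cylinder]; exact Lp.memLp v
  have h3 := (h2.integrable_norm_pow (by norm_num)).prod_right_ae
  filter_upwards [h3, h2.1.prodMk_left] with x hx hm
  have : MemLp (fun z => v (x, z)) 2 (volume.restrict (Ioo (-h) 0)) :=
    (memLp_two_iff_integrable_sq_norm hm).2 (by simpa using hx)
  exact this.integrable (by norm_num)

theorem integral_verticalAverage {D : Set Plane} {h : ℝ} (hh : 0 ≤ h) (v : L2Field D h)
    {φ : Plane → ℝ} {U : Set Plane} (hφ : IsTest U φ) :
    ∫ x in D, inner ℝ (verticalAverage h v x) (gradient φ x) =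
      h⁻¹ * ∫ p in cylinder D h, inner ℝ (v p) (gradient φ p.1) := by
  have hi := integrable_inner_gradient v hφ
  have hf := ae_integrable_fibre v
  generalize (v : Plane × ℝ → Plane) = w at hi hf ⊢
  rw [restrict_cylinder] at hi ⊢
  rw [integral_prod _ hi, ← integral_const_mul]
  refine integral_congr_ae ?_
  filter_upwards [hf] with x hx
  simp only [verticalAverage]
  rw [intervalIntegral.integral_of_le (by linarith), integral_Ioc_eq_integral_Ioo,
    real_inner_smul_left, real_inner_comm, ← integral_inner hx]
  simp only [real_inner_comm]

theorem memH1_iff {D : Set Plane} {h : ℝ} (hh : 0 < h) (v : L2Field D h) :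
    MemH1 D h v ↔ ∀ φ : Plane → ℝ, IsTest univ φ →
      ∫ p in cylinder D h, inner ℝ (v p) (gradient φ p.1) = 0 := by
  constructor
  · intro hv φ hφ
    have := hv.normal_eq_zero φ hφ
    rw [normalTrace, integral_verticalAverage hh.le v hφ] at this
    simpa [hh.ne'] using this
  · intro hv
    refine ⟨fun φ hφ => ?_, fun φ hφ => ?_⟩
    · rw [integral_verticalAverage hh.le v hφ, hv φ ⟨hφ.smooth, hφ.compact, subset_univ _⟩]
      simp
    · rw [normalTrace, integral_verticalAverage hh.le v hφ, hv φ hφ]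
      simp

/-- The space `H₁` of fields whose vertical average is divergence-free with vanishing normal
component on the boundary. -/
noncomputable def H1 (D : Set Plane) (h : ℝ) (hh : 0 < h) : Submodule ℝ (L2Field D h) where
  carrier := {v | MemH1 D h v}
  zero_mem' := by
    refine (memH1_iff hh _).2 fun φ _ => ?_
    refine integral_eq_zero_of_ae ?_
    filter_upwards [Lp.coeFn_zero Plane 2
      ((volume : Measure (Plane × ℝ)).restrict (cylinder D h))] with p hp
    rw [hp]
    simp only [Pi.zero_apply, inner_zero_left]
  add_mem' := by
    intro u v hu hv
    refine (memH1_iff hh _).2 fun φ hφ => ?_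
    have e : ∫ p in cylinder D h, inner ℝ ((u + v : L2Field D h) p) (gradient φ p.1) =
        ∫ p in cylinder D h, (inner ℝ (u p) (gradient φ p.1) +
          inner ℝ (v p) (gradient φ p.1)) := by
      refine integral_congr_ae ?_
      filter_upwards [Lp.coeFn_add u v] with p hp
      rw [hp, Pi.add_apply, inner_add_left]
    rw [e, integral_add (integrable_inner_gradient u hφ) (integrable_inner_gradient v hφ),
      (memH1_iff hh u).1 hu φ hφ, (memH1_iff hh v).1 hv φ hφ, add_zero]
  smul_mem' := by
    intro c u hu
    refine (memH1_iff hh _).2 fun φ hφ => ?_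
    have e : ∫ p in cylinder D h, inner ℝ ((c • u : L2Field D h) p) (gradient φ p.1) =
        ∫ p in cylinder D h, c * inner ℝ (u p) (gradient φ p.1) := by
      refine integral_congr_ae ?_
      filter_upwards [Lp.coeFn_smul c u] with p hp
      rw [hp, Pi.smul_apply, real_inner_smul_left]
    rw [e, integral_const_mul, (memH1_iff hh u).1 hu φ hφ, mul_zero]

/-- `P` is the orthogonal projection of `(L²(Ω))²` onto `H₁`: a self-adjoint idempotent bounded
operator with range `H₁`. -/
def IsLerayProjector (D : Set Plane) (h : ℝ) (hh : 0 < h)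
    (P : L2Field D h →L[ℝ] L2Field D h) : Prop :=
  IsIdempotentElem P ∧ IsSelfAdjoint P ∧ P.range = H1 D h hh

end HydrostaticHelmholtz

open Filter Topology
open scoped ENNReal NNReal Convolution Pointwise

namespace HydrostaticHelmholtz

/-! It suffices to show that `G` is closed and `H1` is its orthogonal complement; the rest is
Hilbert space theory. By Fubini, `H1` consists of the fields orthogonal to the `z`-independent
extensions of gradients of test functions on the whole plane: such test functions encode both the
zero divergence and the zero normal trace of the average. Extension in `z` multiplies norms by `√h`,
so it carries closed subspaces to closed subspaces. Everything thus reduces to a statement on `D`: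
the `L²(D)` closure of the test gradients is exactly the set of gradients of `H¹(D)` functions
(`mem_closure_testGradients_iff`).

Both inclusions use one geometric fact, the uniform cone property of `exists_cone`.

Limits of test gradients are gradients (`exists_isH1WithGradient_of_tendsto`): the cone property
gives a Poincaré inequality near each point of the compact closure of `D`. After subtracting
suitable constants the potentials are Cauchy on each set of a finite cover, and the constants can be
matched on overlaps.

Gradients are limits of test gradients (`integral_inner_eq_zero_of_isH1WithGradient`): by duality it
is enough that a field `w` orthogonal to all test gradients is orthogonal to every `∇q`. Extended by
zero, `w` is divergence-free on the plane. Localize `q` by a partition of unity and mollify `w` with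
kernels centred slightly along the cone direction. The mollified field stays divergence-free and its
support is pushed inside `D` locally, so its product with a cutoff may be tested against `q`; then
let the kernels shrink. -/

/-! ### The uniform cone property. -/

/-- A smooth graph is locally Lipschitz, so moving up steeply enough from a point above the graph
stays above it, even after a small perturbation `z` of the direction. -/
theorem HasSmoothBoundary.exists_cone {D : Set Plane} (hD : IsOpen D) (hs : HasSmoothBoundary D)
    {p : Plane} (hp : p ∈ closure D) :
    ∃ ρ : ℝ, 0 < ρ ∧ ∃ e : Plane, ∀ x ∈ D, x ∈ Metric.ball p ρ → ∀ z : Plane, ‖z‖ < ρ →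
      ∀ t ∈ Icc (0 : ℝ) 1, x + t • (e + z) ∈ D := by
  by_cases hpD : p ∈ D
  · obtain ⟨r, hr, hrD⟩ := Metric.isOpen_iff.1 hD p hpD
    refine ⟨r / 2, by positivity, 0, fun x _ hx z hz t ht => hrD ?_⟩
    rw [Metric.mem_ball, dist_eq_norm] at hx ⊢
    have h1 : x + t • (0 + z) - p = (x - p) + t • z := by rw [zero_add]; abel
    have h2 : ‖t • z‖ ≤ ‖z‖ := by
      rw [norm_smul, Real.norm_of_nonneg ht.1]
      exact mul_le_of_le_one_left (norm_nonneg _) ht.2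
    rw [h1]
    linarith [norm_add_le (x - p) (t • z)]
  · have hfr : p ∈ frontier D := by rw [hD.frontier_eq]; exact ⟨hp, hpD⟩
    obtain ⟨r, hr, A, γ, hγ, hA⟩ := hs p hfr
    obtain ⟨K, s, hs, hK⟩ := ((hγ.of_le (by simp)).contDiffAt (x := (A p) 0)).exists_lipschitzOnWith
    obtain ⟨δ, hδ, hδs⟩ := Metric.mem_nhds_iff.1 hs
    have hK0 : (0 : ℝ) ≤ K := K.2
    -- The bound `δ / 2` keeps the moved first coordinate where `γ` is `K`-Lipschitz; `r / (4 + K)`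
    -- keeps the moved point, at distance below `ρ + H + ρ = ρ * (3 + K)` from `p`, in the chart.
    set ρ : ℝ := min (δ / 2) (r / (4 + K)) with hρdef
    have hρ : 0 < ρ := by positivity
    have hρδ : ρ ≤ δ / 2 := min_le_left _ _
    have hρr : ρ * (4 + K) ≤ r := by
      rw [← le_div_iff₀ (by positivity)]; exact min_le_right _ _
    -- Of the rise `t * H`, the part `t * ρ` absorbs the vertical component of `t • z`, and `K * (t
    -- * ρ)` absorbs the change of `γ`.
    set H : ℝ := ρ * (1 + K) with hH
    set b : Plane := EuclideanSpace.single 1 H with hb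
    have hbn : ‖A.symm b‖ = H := by
      rw [LinearIsometryEquiv.norm_map, hb, PiLp.norm_single,
        Real.norm_of_nonneg (by positivity)]
    refine ⟨ρ, hρ, A.symm b, fun x hxD hx z hz t ht => ?_⟩
    rw [Metric.mem_ball, dist_eq_norm] at hx
    have hAz : ∀ i, |(A z) i| ≤ ‖z‖ := fun i => by
      rw [← A.norm_map z]; exact PiLp.norm_apply_le (A z) i
    have hAx : |(A x) 0 - (A p) 0| < ρ := by
      have := PiLp.norm_apply_le (A (x - p)) 0
      rw [A.norm_map, map_sub] at this
      exact this.trans_lt hx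
    have hxr : x ∈ Metric.ball p r := by
      rw [Metric.mem_ball, dist_eq_norm]; nlinarith
    have hx1 := (hA x hxr).1 hxD
    refine (hA _ ?_).2 ?_
    · rw [Metric.mem_ball, dist_eq_norm]
      have h1 : x + t • (A.symm b + z) - p = (x - p) + t • (A.symm b + z) := by abel
      have h2 : ‖t • (A.symm b + z)‖ ≤ H + ‖z‖ := by
        rw [norm_smul, Real.norm_of_nonneg ht.1]
        refine (mul_le_of_le_one_left (norm_nonneg _) ht.2).trans ?_
        rw [← hbn]; exact norm_add_le _ _
      rw [h1]
      nlinarith [norm_add_le (x - p) (t • (A.symm b + z))]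
    · have e0 : (A (x + t • (A.symm b + z))) 0 = (A x) 0 + t * (A z) 0 := by
        simp [hb]
      have e1 : (A (x + t • (A.symm b + z))) 1 = (A x) 1 + t * (H + (A z) 1) := by
        simp [hb, mul_add]
      rw [e0, e1]
      have ht1 : |t * (A z) 0| ≤ t * ρ := by
        rw [abs_mul, abs_of_nonneg ht.1]
        exact mul_le_mul_of_nonneg_left ((hAz 0).trans hz.le) ht.1
      have htρ : t * ρ ≤ ρ := mul_le_of_le_one_left hρ.le ht.2
      have m1 : (A x) 0 ∈ s := hδs (by rw [Metric.mem_ball, Real.dist_eq]; linarith)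
      have m2 : (A x) 0 + t * (A z) 0 ∈ s := hδs (by
        rw [Metric.mem_ball, Real.dist_eq]
        calc _ = |((A x) 0 - (A p) 0) + t * (A z) 0| := by ring_nf
          _ ≤ _ := abs_add_le _ _
          _ < δ := by linarith)
      have hl := hK.dist_le_mul _ m2 _ m1
      rw [Real.dist_eq, Real.dist_eq, add_sub_cancel_left] at hl
      have h3 : (K : ℝ) * |t * (A z) 0| ≤ K * (t * ρ) := mul_le_mul_of_nonneg_left ht1 hK0
      have h4 := (abs_le.1 (hAz 1)).1
      have h5 : t * (-ρ) ≤ t * (A z) 1 := mul_le_mul_of_nonneg_left (by linarith) ht.1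
      have h6 := le_abs_self (γ ((A x) 0 + t * (A z) 0) - γ ((A x) 0))
      have h7 : t * H = t * ρ + K * (t * ρ) := by rw [hH]; ring
      linarith [mul_add t H ((A z) 1)]

/-! ### Local Poincaré inequalities. -/

theorem enorm_gradient (f : Plane → ℝ) (x : Plane) : ‖gradient f x‖ₑ = ‖fderiv ℝ f x‖ₑ := by
  rw [gradient, ← ofReal_norm, LinearIsometryEquiv.norm_map, ofReal_norm]

theorem lintegral_sq_le {α : Type*} [MeasurableSpace α] {μ : Measure α} [IsProbabilityMeasure μ]
    {f : α → ℝ≥0∞} (hf : AEMeasurable f μ) : (∫⁻ x, f x ∂μ) ^ 2 ≤ ∫⁻ x, f x ^ 2 ∂μ := by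
  have := ENNReal.lintegral_mul_le_Lp_mul_Lq μ Real.HolderConjugate.two_two hf
    (aemeasurable_const (b := (1 : ℝ≥0∞)))
  simp only [Pi.mul_apply, mul_one, ENNReal.rpow_two, one_pow, lintegral_one, measure_univ,
    ENNReal.one_rpow] at this
  calc _ ≤ ((∫⁻ x, f x ^ 2 ∂μ) ^ (1 / 2 : ℝ)) ^ 2 := by gcongr
    _ = _ := by rw [← ENNReal.rpow_two, ← ENNReal.rpow_mul]; norm_num

/-- The fundamental theorem of calculus along the segment, then Cauchy–Schwarz in `t`. -/
theorem enorm_sub_sq_le_lintegral_gradient {f : Plane → ℝ} (hf : ContDiff ℝ ∞ f) (x y : Plane) :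
    ‖f y - f x‖ₑ ^ 2 ≤
      ‖y - x‖ₑ ^ 2 * ∫⁻ t in Icc (0 : ℝ) 1, ‖gradient f (x + t • (y - x))‖ₑ ^ 2 := by
  have hc : Continuous (fun t : ℝ => fderiv ℝ f (x + t • (y - x))) :=
    (hf.continuous_fderiv (by simp)).comp (by fun_prop)
  have hd : ∀ t ∈ uIcc (0 : ℝ) 1, HasDerivAt (fun t : ℝ => f (x + t • (y - x)))
      (fderiv ℝ f (x + t • (y - x)) (y - x)) t := by
    intro t _
    have h1 : HasDerivAt (fun t : ℝ => x + t • (y - x)) (y - x) t := by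
      simpa using ((hasDerivAt_id t).smul_const (y - x)).const_add x
    exact ((hf.differentiable (by simp)).differentiableAt.hasFDerivAt).comp_hasDerivAt t h1
  have hi := intervalIntegral.integral_eq_sub_of_hasDerivAt hd
    ((hc.clm_apply continuous_const).intervalIntegrable _ _)
  simp only [one_smul, add_sub_cancel, zero_smul, add_zero] at hi
  rw [← hi, intervalIntegral.integral_of_le zero_le_one, ← integral_Icc_eq_integral_Ioc]
  have hp : IsProbabilityMeasure ((volume : Measure ℝ).restrict (Icc 0 1)) := ⟨by simp⟩
  calc _ ≤ (∫⁻ t in Icc (0 : ℝ) 1, ‖fderiv ℝ f (x + t • (y - x)) (y - x)‖ₑ) ^ 2 := by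
        gcongr; exact enorm_integral_le_lintegral_enorm _
    _ ≤ ∫⁻ t in Icc (0 : ℝ) 1, ‖fderiv ℝ f (x + t • (y - x)) (y - x)‖ₑ ^ 2 :=
        lintegral_sq_le (hc.clm_apply continuous_const).enorm.aemeasurable
    _ ≤ ∫⁻ t in Icc (0 : ℝ) 1, ‖y - x‖ₑ ^ 2 * ‖gradient f (x + t • (y - x))‖ₑ ^ 2 := by
        gcongr with t
        rw [← mul_pow, enorm_gradient, mul_comm]
        gcongr
        exact ContinuousLinearMap.le_opENorm _ _
    _ = _ := lintegral_const_mul' _ _ (by simp)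

/-- In dimension two the change of variables costs `t⁻²`, which is at most `4`. -/
theorem lintegral_comp_add_smul {Φ : Plane → ℝ≥0∞} (hΦ : Measurable Φ) (a : Plane) {t : ℝ}
    (ht : 1 / 2 ≤ t) : ∫⁻ y, Φ (a + t • y) ≤ 4 * ∫⁻ y, Φ y := by
  have ht0 : t ≠ 0 := by linarith
  have h1 : ∫⁻ y, Φ (a + t • y) = ∫⁻ y, Φ (a + y) ∂(Measure.map (t • ·) volume) :=
    (lintegral_map (hΦ.comp (measurable_const_add a)) (measurable_const_smul t)).symm
  rw [h1, Measure.map_addHaar_smul _ ht0, lintegral_smul_measure, lintegral_add_left_eq_self,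
    smul_eq_mul]
  gcongr
  rw [finrank_euclideanSpace_fin, ← ENNReal.ofReal_ofNat]
  apply ENNReal.ofReal_le_ofReal
  rw [abs_of_nonneg (by positivity), inv_le_comm₀ (by positivity) (by norm_num)]
  nlinarith

/-- After integrating the segment bound, substitute `x + t • (y - x)` for one endpoint. The Jacobian
is `t²` in `y` and `(1 - t)²` in `x`; each degenerates at one end, so `y` is used for `t ≥ 1/2` and
`x` for `t ≤ 1/2`. -/
theorem lintegral_lintegral_sub_sq_le {D V B : Set Plane} (hDo : IsOpen D)
    (hV : MeasurableSet V) (hB : MeasurableSet B) {M : ℝ≥0∞}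
    (hM : ∀ x ∈ V, ∀ y ∈ B, ‖y - x‖ₑ ≤ M)
    (hseg : ∀ x ∈ V, ∀ y ∈ B, ∀ t ∈ Icc (0 : ℝ) 1, x + t • (y - x) ∈ D)
    {f : Plane → ℝ} (hf : ContDiff ℝ ∞ f) :
    ∫⁻ x in V, ∫⁻ y in B, ‖f y - f x‖ₑ ^ 2 ≤
      M ^ 2 * (4 * (volume V + volume B)) * ∫⁻ x in D, ‖gradient f x‖ₑ ^ 2 := by
  -- The cutoff to `D` allows integration over the whole plane after the substitution.
  set Φ : Plane → ℝ≥0∞ := D.indicator (fun x => ‖gradient f x‖ₑ ^ 2) with hΦd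
  have hgc : Continuous (gradient f) :=
    (InnerProductSpace.toDual ℝ Plane).symm.continuous.comp (hf.continuous_fderiv (by simp))
  have hΦ : Measurable Φ := (hgc.enorm.measurable.pow_const 2).indicator hDo.measurableSet
  have hΦi : ∫⁻ x, Φ x = ∫⁻ x in D, ‖gradient f x‖ₑ ^ 2 := lintegral_indicator hDo.measurableSet _
  have key : ∀ t ∈ Icc (0 : ℝ) 1, ∫⁻ x in V, ∫⁻ y in B, Φ (x + t • (y - x)) ≤
      4 * (volume V + volume B) * ∫⁻ x, Φ x := by
    intro t ht
    rcases le_total (1 / 2) t with h2 | h2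
    · calc _ ≤ ∫⁻ x in V, 4 * ∫⁻ y, Φ y := by
            gcongr with x
            refine (setLIntegral_le_lintegral _ _).trans ?_
            have : ∀ y, x + t • (y - x) = (x - t • x) + t • y := fun y => by
              rw [smul_sub]; abel
            simp only [this]
            exact lintegral_comp_add_smul hΦ _ h2
        _ = 4 * volume V * ∫⁻ y, Φ y := by rw [setLIntegral_const]; ring
        _ ≤ _ := by gcongr; exact le_self_add
    · have hm : AEMeasurable (Function.uncurry fun x y : Plane => Φ (x + t • (y - x)))
          ((volume.restrict V).prod (volume.restrict B)) :=
        (hΦ.comp (by fun_prop : Measurable fun q : Plane × Plane =>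
          q.1 + t • (q.2 - q.1))).aemeasurable
      rw [lintegral_lintegral_swap hm]
      calc _ ≤ ∫⁻ y in B, 4 * ∫⁻ x, Φ x := by
            gcongr with y
            refine (setLIntegral_le_lintegral _ _).trans ?_
            have : ∀ x, x + t • (y - x) = t • y + (1 - t) • x := fun x => by
              rw [smul_sub, sub_smul, one_smul]; abel
            simp only [this]
            exact lintegral_comp_add_smul hΦ _ (by linarith)
        _ = 4 * volume B * ∫⁻ y, Φ y := by rw [setLIntegral_const]; ring
        _ ≤ _ := by gcongr; exact le_add_self
  rw [← hΦi]
  calc _ ≤ ∫⁻ x in V, ∫⁻ y in B, M ^ 2 * ∫⁻ t in Icc (0 : ℝ) 1, Φ (x + t • (y - x)) := by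
        refine setLIntegral_mono' hV fun x hx => setLIntegral_mono' hB fun y hy => ?_
        refine (enorm_sub_sq_le_lintegral_gradient hf x y).trans ?_
        gcongr ?_ ^ 2 * ?_
        · exact hM x hx y hy
        · refine setLIntegral_mono' measurableSet_Icc fun t ht => ?_
          rw [hΦd, indicator_of_mem (hseg x hx y hy t ht)]
    _ = M ^ 2 * ∫⁻ x in V, ∫⁻ t in Icc (0 : ℝ) 1, ∫⁻ y in B, Φ (x + t • (y - x)) := by
        have hmx : Measurable (fun x : Plane => ∫⁻ t in Icc (0 : ℝ) 1, ∫⁻ y in B,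
            Φ (x + t • (y - x))) := by
          refine Measurable.lintegral_prod_right' (f := fun q : Plane × ℝ => ∫⁻ y in B,
            Φ (q.1 + q.2 • (y - q.1))) ?_
          exact Measurable.lintegral_prod_right' (f := fun q : (Plane × ℝ) × Plane =>
            Φ (q.1.1 + q.1.2 • (q.2 - q.1.1))) (hΦ.comp (by fun_prop))
        rw [← lintegral_const_mul _ hmx]
        refine lintegral_congr fun x => ?_
        rw [lintegral_const_mul, lintegral_lintegral_swap]
        · exact (hΦ.comp (by fun_prop : Measurable fun q : Plane × ℝ =>
            x + q.2 • (q.1 - x))).aemeasurable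
        · exact Measurable.lintegral_prod_right' (f := fun q : Plane × ℝ =>
            Φ (x + q.2 • (q.1 - x))) (hΦ.comp (by fun_prop))
    _ = M ^ 2 * ∫⁻ t in Icc (0 : ℝ) 1, ∫⁻ x in V, ∫⁻ y in B, Φ (x + t • (y - x)) := by
        rw [lintegral_lintegral_swap]
        refine Measurable.aemeasurable ?_
        exact Measurable.lintegral_prod_right' (f := fun q : (Plane × ℝ) × Plane =>
            Φ (q.1.1 + q.1.2 • (q.2 - q.1.1))) (hΦ.comp (by fun_prop))
    _ ≤ M ^ 2 * ∫⁻ t in Icc (0 : ℝ) 1, 4 * (volume V + volume B) * ∫⁻ x, Φ x := by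
        gcongr M ^ 2 * ?_
        exact setLIntegral_mono' measurableSet_Icc key
    _ = _ := by rw [setLIntegral_const]; simp [mul_assoc]

/-- A Poincaré inequality on `V` with the average taken over `B`, when all segments from `V` to
`B` stay inside `D`. -/
theorem eLpNorm_sub_average_le {D V B : Set Plane} (hDo : IsOpen D)
    (hV : MeasurableSet V) (hVf : volume V ≠ ⊤) (hB : MeasurableSet B) (hB0 : volume B ≠ 0)
    (hBf : volume B ≠ ⊤) {M : ℝ≥0∞} (hMf : M ≠ ⊤)
    (hM : ∀ x ∈ V, ∀ y ∈ B, ‖y - x‖ₑ ≤ M)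
    (hseg : ∀ x ∈ V, ∀ y ∈ B, ∀ t ∈ Icc (0 : ℝ) 1, x + t • (y - x) ∈ D) :
    ∃ C : ℝ≥0∞, C ≠ ⊤ ∧ ∀ f : Plane → ℝ, ContDiff ℝ ∞ f → HasCompactSupport f →
      eLpNorm (fun x => f x - ⨍ y in B, f y) 2 (volume.restrict V) ≤
        C * eLpNorm (gradient f) 2 (volume.restrict D) := by
  set C := (volume B)⁻¹ * (M ^ 2 * (4 * (volume V + volume B))) with hC
  have hCf : C ≠ ⊤ := by
    refine ENNReal.mul_ne_top (ENNReal.inv_ne_top.2 hB0) ?_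
    refine ENNReal.mul_ne_top (ENNReal.pow_ne_top hMf) (ENNReal.mul_ne_top (by simp) ?_)
    exact ENNReal.add_ne_top.2 ⟨hVf, hBf⟩
  have hnorm : ∀ {F : Type} [NormedAddCommGroup F] (g : Plane → F) (μ : Measure Plane),
      eLpNorm g 2 μ = (∫⁻ x, ‖g x‖ₑ ^ 2 ∂μ) ^ (1 / 2 : ℝ) := by
    intro F _ g μ
    rw [eLpNorm_eq_lintegral_rpow_enorm_toReal (by simp) (by simp)]
    simp
  refine ⟨C ^ (1 / 2 : ℝ), ENNReal.rpow_ne_top_of_nonneg (by norm_num) hCf, fun f hf hfc => ?_⟩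
  rw [hnorm, hnorm, ← ENNReal.mul_rpow_of_nonneg _ _ (by norm_num)]
  refine ENNReal.rpow_le_rpow ?_ (by norm_num)
  have hfi : Integrable f := hf.continuous.integrable_of_hasCompactSupport hfc
  -- Jensen's inequality for the normalized measure on `B`.
  have hpt : ∀ x, ‖f x - ⨍ y in B, f y‖ₑ ^ 2 ≤
      (volume B)⁻¹ * ∫⁻ y in B, ‖f y - f x‖ₑ ^ 2 := by
    intro x
    have : NeZero (volume.restrict B) := ⟨by simpa using hB0⟩
    have : IsFiniteMeasure (volume.restrict B) := ⟨by simpa using hBf.lt_top⟩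
    set ν := (volume.restrict B univ)⁻¹ • volume.restrict B with hν
    have hνp : IsProbabilityMeasure ν := by rw [hν]; infer_instance
    have hfν : Integrable f ν := hfi.restrict.smul_measure (by simp [hB0])
    have e1 : f x - ⨍ y in B, f y = -∫ y, (f y - f x) ∂ν := by
      rw [integral_sub hfν (integrable_const _), average, ← hν]; simp
    have e2 : (volume B)⁻¹ * ∫⁻ y in B, ‖f y - f x‖ₑ ^ 2 = ∫⁻ y, ‖f y - f x‖ₑ ^ 2 ∂ν := by
      rw [hν, lintegral_smul_measure, smul_eq_mul, Measure.restrict_apply_univ]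
    rw [e1, e2, enorm_neg]
    refine le_trans (pow_le_pow_left' (enorm_integral_le_lintegral_enorm _) 2) ?_
    exact lintegral_sq_le (hf.continuous.sub continuous_const).enorm.aemeasurable
  calc _ ≤ ∫⁻ x in V, (volume B)⁻¹ * ∫⁻ y in B, ‖f y - f x‖ₑ ^ 2 := lintegral_mono hpt
    _ = (volume B)⁻¹ * ∫⁻ x in V, ∫⁻ y in B, ‖f y - f x‖ₑ ^ 2 :=
        lintegral_const_mul' _ _ (ENNReal.inv_ne_top.2 hB0)
    _ ≤ _ := by
        rw [hC, mul_assoc]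
        gcongr
        exact lintegral_lintegral_sub_sq_le hDo hV hB hM hseg hf

theorem IsTest.integrable {U : Set Plane} {f : Plane → ℝ} (hf : IsTest U f) : Integrable f :=
  hf.smooth.continuous.integrable_of_hasCompactSupport hf.compact

theorem IsTest.sub {f g : Plane → ℝ} (hf : IsTest univ f) (hg : IsTest univ g) :
    IsTest univ (f - g) :=
  ⟨hf.smooth.sub hg.smooth, hf.compact.sub hg.compact, subset_univ _⟩

theorem IsTest.gradient_sub {f g : Plane → ℝ} (hf : IsTest univ f) (hg : IsTest univ g) :
    gradient (f - g) = gradient f - gradient g := by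
  ext1 x
  simp only [gradient, Pi.sub_apply, ← map_sub]
  rw [fderiv_sub (hf.smooth.differentiable (by simp)).differentiableAt
    (hg.smooth.differentiable (by simp)).differentiableAt]

/-- For `x` near `p` and `y` near `p + e`, the difference `y - x` is a small perturbation of `e`, so
the cone property keeps the segment in `D`. The constant `c f` is the mean of `f` near `p + e`; the
form with two functions serves for Cauchy sequences. -/
theorem exists_local_poincare {D : Set Plane} (hD : IsOpen D)
    (hs : HasSmoothBoundary D) {p : Plane} (hp : p ∈ closure D) :
    ∃ ρ : ℝ, 0 < ρ ∧ ∃ (c : (Plane → ℝ) → ℝ) (C : ℝ≥0∞), C ≠ ⊤ ∧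
      ∀ f g : Plane → ℝ, IsTest univ f → IsTest univ g →
        eLpNorm (fun x => (f x - c f) - (g x - c g)) 2
            (volume.restrict (D ∩ Metric.ball p ρ)) ≤
          C * eLpNorm (gradient f - gradient g) 2 (volume.restrict D) := by
  obtain ⟨ρ, hρ, e, he⟩ := hs.exists_cone hD hp
  have hρ2 : 0 < ρ / 2 := by positivity
  set V := D ∩ Metric.ball p (ρ / 2)
  set B := Metric.ball (p + e) (ρ / 2)
  have hsub : ∀ x ∈ V, ∀ y ∈ B, y - x = e + (y - x - e) ∧ ‖y - x - e‖ < ρ := by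
    intro x hx y hy
    refine ⟨by abel, ?_⟩
    have h1 := hx.2
    rw [Metric.mem_ball, dist_eq_norm] at h1 hy
    have : y - x - e = (y - (p + e)) - (x - p) := by abel
    rw [this]
    linarith [norm_sub_le (y - (p + e)) (x - p)]
  obtain ⟨C, hC, hP⟩ := eLpNorm_sub_average_le (D := D) (V := V) (B := B)
    (M := ENNReal.ofReal (‖e‖ + ρ)) hD
    (hD.inter Metric.isOpen_ball).measurableSet
    ((measure_mono inter_subset_right).trans_lt measure_ball_lt_top).ne
    Metric.isOpen_ball.measurableSet (Metric.measure_ball_pos _ _ hρ2).ne'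
    measure_ball_lt_top.ne ENNReal.ofReal_ne_top
    (fun x hx y hy => by
      rw [← ofReal_norm]
      apply ENNReal.ofReal_le_ofReal
      rw [(hsub x hx y hy).1]
      linarith [norm_add_le e (y - x - e), (hsub x hx y hy).2])
    (fun x hx y hy t ht => by
      rw [(hsub x hx y hy).1]
      exact he x hx.1 (Metric.ball_subset_ball (by linarith) hx.2) _ (hsub x hx y hy).2 t ht)
  refine ⟨ρ / 2, hρ2, fun f => ⨍ y in B, f y, C, hC, fun f g hf hg => ?_⟩
  have h := hP (f - g) (hf.sub hg).smooth (hf.sub hg).compact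
  rw [hf.gradient_sub hg] at h
  refine le_trans (le_of_eq ?_) h
  congr 1
  ext x
  have : ⨍ y in B, (f - g) y = (⨍ y in B, f y) - ⨍ y in B, g y := by
    simp only [average_eq, Pi.sub_apply]
    rw [integral_sub hf.integrable.restrict hg.integrable.restrict, smul_sub]
  rw [this, Pi.sub_apply]
  ring

theorem exists_poincare_cover {D : Set Plane} (hD : IsOpen D) (hb : Bornology.IsBounded D)
    (hs : HasSmoothBoundary D) :
    ∃ (ι : Type) (_ : Fintype ι) (V : ι → Set Plane) (c : ι → (Plane → ℝ) → ℝ) (C : ι → ℝ≥0∞),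
      (∀ i, IsOpen (V i)) ∧ D = ⋃ i, V i ∧ (∀ i, C i ≠ ⊤) ∧
      ∀ i, ∀ f g : Plane → ℝ, IsTest univ f → IsTest univ g →
        eLpNorm (fun x => (f x - c i f) - (g x - c i g)) 2 (volume.restrict (V i)) ≤
          C i * eLpNorm (gradient f - gradient g) 2 (volume.restrict D) := by
  choose ρ hρ c C hC hP using fun p : closure D => exists_local_poincare hD hs p.2
  obtain ⟨t, ht⟩ := hb.isCompact_closure.elim_nhds_subcover'
    (fun p hp => Metric.ball p (ρ ⟨p, hp⟩)) (fun p hp => Metric.ball_mem_nhds p (hρ ⟨p, hp⟩))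
  refine ⟨t, inferInstance, fun i => D ∩ Metric.ball i.1 (ρ i.1), fun i => c i.1, fun i => C i.1,
    fun i => hD.inter Metric.isOpen_ball, ?_, fun i => hC i.1, fun i => hP i.1⟩
  refine Subset.antisymm (fun x hx => ?_) (iUnion_subset fun i => inter_subset_left)
  obtain ⟨i, hi, hxi⟩ := mem_iUnion₂.1 (ht (subset_closure hx))
  exact mem_iUnion.2 ⟨⟨i, hi⟩, hx, hxi⟩

/-! ### Limits of test gradients are gradients. -/

theorem eLpNorm_two_iUnion_le {α ι : Type*} [MeasurableSpace α] {μ : Measure α} [Fintype ι]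
    (V : ι → Set α) (f : α → ℝ) :
    eLpNorm f 2 (μ.restrict (⋃ i, V i)) ≤ ∑ i, eLpNorm f 2 (μ.restrict (V i)) := by
  simp only [eLpNorm_eq_lintegral_rpow_enorm_toReal (two_ne_zero) (ENNReal.ofNat_ne_top (n := 2))]
  refine (ENNReal.rpow_le_rpow (lintegral_iUnion_le _ _) (by norm_num)).trans ?_
  rw [tsum_fintype]
  refine Finset.le_sum_of_subadditive (fun x : ℝ≥0∞ => x ^ (1 / (2 : ℝ≥0∞).toReal)) ?_ ?_ _ _
  · simp
  · intro x y
    exact ENNReal.rpow_add_le_add_rpow x y (by norm_num) (by norm_num)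

theorem cauchySeq_iff_tendsto_edist {α : Type*} [PseudoMetricSpace α] {u : ℕ → α} :
    CauchySeq u ↔ Tendsto (fun p : ℕ × ℕ => edist (u p.1) (u p.2)) atTop (𝓝 0) := by
  rw [cauchySeq_iff_tendsto_dist_atTop_0]
  constructor
  · intro h
    simpa [edist_dist] using ENNReal.tendsto_ofReal h
  · intro h
    have := (ENNReal.tendsto_toReal ENNReal.zero_ne_top).comp h
    simpa [Function.comp_def, ← dist_edist] using this

theorem tendsto_integral_mul {α : Type*} [MeasurableSpace α] {μ : Measure α} {a F : α → ℝ}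
    {f : ℕ → α → ℝ} (ha : MemLp a 2 μ) (hf : ∀ n, MemLp (f n) 2 μ) (hF : MemLp F 2 μ)
    (h : Tendsto (fun n => eLpNorm (f n - F) 2 μ) atTop (𝓝 0)) :
    Tendsto (fun n => ∫ x, a x * f n x ∂μ) atTop (𝓝 (∫ x, a x * F x ∂μ)) := by
  have e : ∀ {g : α → ℝ} (hg : MemLp g 2 μ),
      inner ℝ (ha.toLp a) (hg.toLp g) = ∫ x, a x * g x ∂μ := by
    intro g hg
    rw [L2.inner_def]
    refine integral_congr_ae ?_
    filter_upwards [ha.coeFn_toLp, hg.coeFn_toLp] with x h1 h2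
    rw [h1, h2, real_inner_eq_re_inner, RCLike.inner_apply]
    simp [mul_comm]
  have := (tendsto_const_nhds (x := ha.toLp a)).inner (𝕜 := ℝ)
    ((Lp.tendsto_Lp_iff_tendsto_eLpNorm'' f hf F hF).2 h)
  rw [e hF] at this
  exact this.congr fun n => e (hf n)

theorem gradient_apply_eq_fderiv (f : Plane → ℝ) (x : Plane) (i : Fin 2) :
    gradient f x i = fderiv ℝ f x (EuclideanSpace.single i 1) := by
  have h := InnerProductSpace.toDual_symm_apply (𝕜 := ℝ) (x := EuclideanSpace.single i (1 : ℝ))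
    (y := fderiv ℝ f x)
  rw [← h, ← gradient, EuclideanSpace.inner_single_right]
  simp

/-- As `θ` is supported in `D`, both integrals extend to the plane, and `ψ` need only be
differentiable inside `D`. -/
theorem IsTest.setIntegral_fderiv_mul {D : Set Plane} {θ ψ : Plane → ℝ}
    (hθ : IsTest D θ) (hψm : MemLp ψ 2 (volume.restrict D))
    (hψ : ∀ x ∈ D, DifferentiableAt ℝ ψ x) (v : Plane)
    (hψ' : MemLp (fun x => fderiv ℝ ψ x v) 2 (volume.restrict D)) :
    ∫ x in D, fderiv ℝ θ x v * ψ x = - ∫ x in D, θ x * fderiv ℝ ψ x v := by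
  have h0 : ∀ x, x ∉ D → θ x = 0 := fun x hx => image_eq_zero_of_notMem_tsupport
    fun h => hx (hθ.supp h)
  have h1 : ∀ x, x ∉ D → fderiv ℝ θ x v = 0 := fun x hx => by
    rw [image_eq_zero_of_notMem_tsupport (f := fderiv ℝ θ) fun h =>
      hx (hθ.supp (tsupport_fderiv_subset ℝ h))]
    rfl
  have hint : ∀ {a b : Plane → ℝ}, (∀ x, x ∉ D → a x = 0) → MemLp a 2 (volume.restrict D) →
      MemLp b 2 (volume.restrict D) → Integrable fun x => a x * b x := by
    intro a b ha ham hbm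
    refine (integrableOn_iff_integrable_of_support_subset (s := D) ?_).1
      (integrable_smul_of_memLp ham hbm)
    intro x hx
    by_contra hxD
    exact hx (by simp [ha x hxD])
  rw [setIntegral_eq_integral_of_forall_compl_eq_zero (fun x hx => by rw [h1 x hx, zero_mul]),
    setIntegral_eq_integral_of_forall_compl_eq_zero (fun x hx => by rw [h0 x hx, zero_mul]),
    integral_mul_fderiv_eq_neg_fderiv_mul_of_integrable (hint h1 (hθ.memLp_fderiv v) hψm)
      (hint h0 hθ.memLp hψ') (hint h0 hθ.memLp hψm)
      (fun x _ => (hθ.smooth.differentiable (by simp)).differentiableAt)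
      (fun x hx => hψ x (hθ.supp hx)), neg_neg]

/-- Gradients of test functions converging in `L²(D)` converge to the gradient of an `H¹`
function. -/
theorem exists_isH1WithGradient_of_tendsto {D : Set Plane} (hD : IsOpen D)
    (hb : Bornology.IsBounded D) (hs : HasSmoothBoundary D) {φ : ℕ → Plane → ℝ}
    (hφ : ∀ n, IsTest univ (φ n)) {g : Plane → Plane} (hg : MemLp g 2 (volume.restrict D))
    (hlim : Tendsto (fun n => eLpNorm (gradient (φ n) - g) 2 (volume.restrict D)) atTop (𝓝 0)) :
    ∃ q, IsH1WithGradient D q g := by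
  classical
  obtain ⟨ι, _, V, c, C, hVo, hDV, hC, hP⟩ := exists_poincare_cover hD hb hs
  have hVD : ∀ i, V i ⊆ D := fun i => hDV ▸ subset_iUnion V i
  have hDf : volume D < ⊤ := hb.measure_lt_top
  have hVf : ∀ i, volume (V i) < ⊤ := fun i => (measure_mono (hVD i)).trans_lt hDf
  have : ∀ i, IsFiniteMeasure (volume.restrict (V i)) := fun i => ⟨by simpa using hVf i⟩
  have hgm : ∀ n, MemLp (gradient (φ n)) 2 (volume.restrict D) := fun n => (hφ n).memLp_gradient
  have tfst : Tendsto (Prod.fst : ℕ × ℕ → ℕ) atTop atTop := by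
    rw [← prod_atTop_atTop_eq]; exact tendsto_fst
  have tsnd : Tendsto (Prod.snd : ℕ × ℕ → ℕ) atTop atTop := by
    rw [← prod_atTop_atTop_eq]; exact tendsto_snd
  have hgrad : Tendsto (fun p : ℕ × ℕ => eLpNorm (gradient (φ p.1) - gradient (φ p.2)) 2
      (volume.restrict D)) atTop (𝓝 0) := by
    have h1 := (hlim.comp tfst).add (hlim.comp tsnd)
    rw [add_zero] at h1
    refine tendsto_of_tendsto_of_tendsto_of_le_of_le tendsto_const_nhds h1 (fun _ => zero_le)
      fun p => ?_
    have : gradient (φ p.1) - gradient (φ p.2) =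
        (gradient (φ p.1) - g) - (gradient (φ p.2) - g) := by abel
    rw [this]
    exact eLpNorm_sub_le ((hgm _).sub hg).1 ((hgm _).sub hg).1 one_le_two
  have hloc : ∀ i, Tendsto (fun p : ℕ × ℕ => eLpNorm (fun x => (φ p.1 x - c i (φ p.1)) -
      (φ p.2 x - c i (φ p.2))) 2 (volume.restrict (V i))) atTop (𝓝 0) := by
    intro i
    have h1 := ENNReal.Tendsto.const_mul hgrad (Or.inr (hC i))
    rw [mul_zero] at h1
    exact tendsto_of_tendsto_of_tendsto_of_le_of_le tendsto_const_nhds h1 (fun _ => zero_le)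
      fun p => hP i _ _ (hφ _) (hφ _)
  have hcont : ∀ n, Continuous (φ n) := fun n => (hφ n).smooth.continuous
  -- On an overlap, which is open and hence of positive measure, the difference of constants is a
  -- difference of two `L²` Cauchy sequences.
  have hover : ∀ i j, (V i ∩ V j).Nonempty → CauchySeq fun n => c i (φ n) - c j (φ n) := by
    intro i j hij
    set W := V i ∩ V j
    have hW0 : volume W ≠ 0 := (((hVo i).inter (hVo j)).measure_pos _ hij).ne'
    have hWf : volume W ≠ ⊤ := ((measure_mono inter_subset_left).trans_lt (hVf i)).ne
    rw [cauchySeq_iff_tendsto_edist]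
    have h1 := (hloc j).add (hloc i)
    rw [add_zero] at h1
    have h2 := ENNReal.Tendsto.mul_const (b := (volume W ^ (1 / (2 : ℝ≥0∞).toReal))⁻¹) h1
      (Or.inr (ENNReal.inv_ne_top.2 (by simp [hW0])))
    rw [zero_mul] at h2
    refine tendsto_of_tendsto_of_tendsto_of_le_of_le tendsto_const_nhds h2 (fun _ => zero_le)
      fun p => ?_
    have hle : eLpNorm (fun _ : Plane => (c i (φ p.1) - c j (φ p.1)) -
        (c i (φ p.2) - c j (φ p.2))) 2 (volume.restrict W) ≤
        eLpNorm (fun x => (φ p.1 x - c j (φ p.1)) - (φ p.2 x - c j (φ p.2))) 2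
          (volume.restrict (V j)) +
        eLpNorm (fun x => (φ p.1 x - c i (φ p.1)) - (φ p.2 x - c i (φ p.2))) 2
          (volume.restrict (V i)) := by
      have hm : ∀ k, Continuous (fun x => (φ p.1 x - c k (φ p.1)) - (φ p.2 x - c k (φ p.2))) :=
        fun k => ((hcont _).sub continuous_const).sub ((hcont _).sub continuous_const)
      calc _ = eLpNorm ((fun x => (φ p.1 x - c j (φ p.1)) - (φ p.2 x - c j (φ p.2))) -
            (fun x => (φ p.1 x - c i (φ p.1)) - (φ p.2 x - c i (φ p.2)))) 2
              (volume.restrict W) := by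
            congr 1; ext x; simp only [Pi.sub_apply]; ring
        _ ≤ _ := eLpNorm_sub_le (hm j).aestronglyMeasurable (hm i).aestronglyMeasurable one_le_two
        _ ≤ _ := add_le_add
            (eLpNorm_mono_measure _ (Measure.restrict_mono inter_subset_right le_rfl))
            (eLpNorm_mono_measure _ (Measure.restrict_mono inter_subset_left le_rfl))
    rw [eLpNorm_const _ two_ne_zero (by simpa using hW0), Measure.restrict_apply_univ] at hle
    rw [edist_eq_enorm_sub, ← div_eq_mul_inv, ENNReal.le_div_iff_mul_le]
    · exact hle
    · left; simp [hW0, hWf]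
    · left; exact ENNReal.rpow_ne_top_of_nonneg (by norm_num) hWf
  -- Chains of overlapping sets are grouped into classes, and every set of a class uses the
  -- constants of one representative. No connectedness of `D` is needed.
  let S : Setoid ι :=
    { r := fun i j => CauchySeq fun n => c i (φ n) - c j (φ n)
      iseqv :=
        { refl := fun i => by simpa using cauchySeq_const (0 : ℝ)
          symm := fun {i j} h => by simpa [Pi.neg_def] using h.neg
          trans := fun {i j k} h h' => by simpa [Pi.add_def] using h.add h' } }
  let rep : ι → ι := fun i => (Quotient.mk S i).out
  have hrep : ∀ i, CauchySeq fun n => c i (φ n) - c (rep i) (φ n) := fun i =>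
    S.symm (Quotient.mk_out (s := S) i)
  have hrep_eq : ∀ i j, (V i ∩ V j).Nonempty → rep i = rep j := fun i j hij =>
    congrArg Quotient.out (Quotient.sound (s := S) (hover i j hij))
  -- The subtracted constant is independent of the chosen `V i` containing `x`, as overlapping sets
  -- share a representative. It is locally constant on `D`, so gradients do not change.
  let ψ : ℕ → Plane → ℝ := fun n x =>
    φ n x - if hx : ∃ i, x ∈ V i then c (rep hx.choose) (φ n) else 0
  have hψ : ∀ n i, ∀ x ∈ V i, ψ n x = φ n x - c (rep i) (φ n) := by
    intro n i x hx
    have hx' : ∃ i, x ∈ V i := ⟨i, hx⟩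
    simp only [ψ, dif_pos hx']
    rw [hrep_eq _ _ ⟨x, hx'.choose_spec, hx⟩]
  have hψev : ∀ n i, ∀ x ∈ V i, ψ n =ᶠ[𝓝 x] fun y => φ n y - c (rep i) (φ n) := fun n i x hx => by
    filter_upwards [(hVo i).mem_nhds hx] with y hy using hψ n i y hy
  have hDmem : ∀ x ∈ D, ∃ i, x ∈ V i := fun x hx => by rw [hDV] at hx; exact mem_iUnion.1 hx
  have hφd : ∀ n, Differentiable ℝ (φ n) := fun n => (hφ n).smooth.differentiable (by simp)
  have hψd : ∀ n, ∀ x ∈ D, DifferentiableAt ℝ (ψ n) x ∧ fderiv ℝ (ψ n) x = fderiv ℝ (φ n) x := by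
    intro n x hx
    obtain ⟨i, hi⟩ := hDmem x hx
    refine ⟨((hφd n x).sub_const _).congr_of_eventuallyEq (hψev n i x hi), ?_⟩
    rw [(hψev n i x hi).fderiv_eq, fderiv_sub_const]
  have hψae : ∀ n i, ψ n =ᵐ[volume.restrict (V i)] fun x => φ n x - c (rep i) (φ n) :=
    fun n i => (ae_restrict_iff' (hVo i).measurableSet).2 (ae_of_all _ (hψ n i))
  have hψL : ∀ n, MemLp (ψ n) 2 (volume.restrict D) := by
    intro n
    refine ⟨?_, ?_⟩
    · exact ContinuousOn.aestronglyMeasurable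
        (fun x hx => (hψd n x hx).1.continuousAt.continuousWithinAt) hD.measurableSet
    · rw [hDV]
      refine (eLpNorm_two_iUnion_le V _).trans_lt (ENNReal.sum_lt_top.2 fun i _ => ?_)
      rw [eLpNorm_congr_ae (hψae n i)]
      exact ((hφ n).memLp.sub (memLp_const _)).2
  have hψcauchy : CauchySeq fun n => (hψL n).toLp (ψ n) := by
    rw [cauchySeq_iff_tendsto_edist]
    have hsum : Tendsto (fun p : ℕ × ℕ => ∑ i, (eLpNorm (fun x => (φ p.1 x - c i (φ p.1)) -
        (φ p.2 x - c i (φ p.2))) 2 (volume.restrict (V i)) +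
        edist (c i (φ p.1) - c (rep i) (φ p.1)) (c i (φ p.2) - c (rep i) (φ p.2)) *
          volume (V i) ^ (1 / (2 : ℝ≥0∞).toReal))) atTop (𝓝 0) := by
      have h0 : (0 : ℝ≥0∞) = ∑ _i : ι, 0 := Finset.sum_const_zero.symm
      rw [h0]
      refine tendsto_finsetSum _ fun i _ => ?_
      have h2 := ENNReal.Tendsto.mul_const (b := volume (V i) ^ (1 / (2 : ℝ≥0∞).toReal))
        (cauchySeq_iff_tendsto_edist.1 (hrep i))
        (Or.inr (ENNReal.rpow_ne_top_of_nonneg (by norm_num) (hVf i).ne))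
      simpa using (hloc i).add h2
    refine tendsto_of_tendsto_of_tendsto_of_le_of_le tendsto_const_nhds hsum (fun _ => zero_le)
      fun p => ?_
    rw [Lp.edist_toLp_toLp]
    conv_lhs => rw [hDV]
    refine (eLpNorm_two_iUnion_le V _).trans (Finset.sum_le_sum fun i _ => ?_)
    calc _ = eLpNorm ((fun x => (φ p.1 x - c i (φ p.1)) - (φ p.2 x - c i (φ p.2))) +
          fun _ => (c i (φ p.1) - c (rep i) (φ p.1)) - (c i (φ p.2) - c (rep i) (φ p.2))) 2
          (volume.restrict (V i)) := by
          refine eLpNorm_congr_ae ?_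
          filter_upwards [hψae p.1 i, hψae p.2 i] with x h1 h2
          simp only [Pi.sub_apply, Pi.add_apply, h1, h2]
          ring
      _ ≤ _ := eLpNorm_add_le (((hcont _).sub continuous_const).sub
          ((hcont _).sub continuous_const)).aestronglyMeasurable
          aestronglyMeasurable_const one_le_two
      _ ≤ _ := by
          refine add_le_add le_rfl ?_
          by_cases h0 : volume.restrict (V i) = 0
          · simp [h0]
          · rw [eLpNorm_const _ two_ne_zero h0, Measure.restrict_apply_univ, edist_eq_enorm_sub]
  obtain ⟨Q, hQ⟩ := cauchySeq_tendsto_of_complete hψcauchy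
  have hQ' := (Lp.tendsto_Lp_iff_tendsto_eLpNorm' _ _).1 hQ
  have hψQ : Tendsto (fun n => eLpNorm (ψ n - (Q : Plane → ℝ)) 2 (volume.restrict D)) atTop (𝓝 0) := by
    refine hQ'.congr fun n => eLpNorm_congr_ae ?_
    filter_upwards [(hψL n).coeFn_toLp] with x hx
    simp [hx]
  refine ⟨Q, Lp.memLp Q, hg, fun i θ hθ => ?_⟩
  have hcoord : ∀ {G : Plane → Plane}, MemLp G 2 (volume.restrict D) →
      MemLp (fun x => G x i) 2 (volume.restrict D) := fun hG =>
    (EuclideanSpace.proj (𝕜 := ℝ) i).comp_memLp' hG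
  have hgi : Tendsto (fun n => eLpNorm ((fun x => gradient (φ n) x i) - fun x => g x i) 2
      (volume.restrict D)) atTop (𝓝 0) := by
    refine tendsto_of_tendsto_of_tendsto_of_le_of_le tendsto_const_nhds hlim (fun _ => zero_le)
      fun n => eLpNorm_mono fun x => ?_
    exact PiLp.norm_apply_le ((gradient (φ n) - g) x) i
  have l1 := tendsto_integral_mul (hθ.memLp_fderiv (EuclideanSpace.single i (1 : ℝ)))
    hψL (Lp.memLp Q) hψQ
  have l2 := (tendsto_integral_mul hθ.memLp (fun n => hcoord (hgm n)) (hcoord hg) hgi).neg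
  -- Integration by parts holds for each `ψ n`, and both sides converge.
  refine tendsto_nhds_unique l1 (l2.congr fun n => ?_)
  have e : ∀ x ∈ D, fderiv ℝ (ψ n) x (EuclideanSpace.single i 1) = gradient (φ n) x i :=
    fun x hx => by rw [(hψd n x hx).2, gradient_apply_eq_fderiv]
  rw [hθ.setIntegral_fderiv_mul (hψL n) (fun x hx => (hψd n x hx).1)]
  · congr 1
    exact setIntegral_congr_fun hD.measurableSet fun x hx => by simp only [e x hx]
  · refine (memLp_congr_ae ?_).2 (hcoord (hgm n))
    exact (ae_restrict_iff' hD.measurableSet).2 (ae_of_all _ e)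

/-! ### Mollification of divergence-free fields. -/

/-- Translation acts continuously on `L²`. -/
theorem continuous_integral_translate_mul {a b : Plane → ℝ} (ha : MemLp a 2 volume)
    (hb : MemLp b 2 volume) : Continuous fun h : Plane => ∫ x, a (x - h) * b x := by
  have e : ∀ h : Plane, ∫ x, a (x - h) * b x =
      inner ℝ (hb.toLp b) ((DomAddAct.mk (-h)) +ᵥ ha.toLp a) := by
    intro h
    rw [DomAddAct.mk_vadd_toLp, L2.inner_def]
    refine integral_congr_ae ?_
    filter_upwards [hb.coeFn_toLp,
      (ha.comp_measurePreserving <| measurePreserving_vadd (-h) volume).coeFn_toLp] with x h1 h2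
    simp only [Function.comp_def] at h2
    rw [h1, h2, real_inner_eq_re_inner, RCLike.inner_apply]
    simp [sub_eq_neg_add]
  simp only [e]
  have : Fact ((2 : ℝ≥0∞) ≠ ⊤) := ⟨by simp⟩
  have hc : Continuous fun h : Plane => DomAddAct.mk (-h) :=
    DomAddAct.continuous_mk.comp continuous_neg
  exact continuous_const.inner (hc.vadd continuous_const)

theorem integral_convolution_mul {k a b : Plane → ℝ} (hk : Continuous k)
    (hkc : HasCompactSupport k) (ham : StronglyMeasurable a) (ha : MemLp a 2 volume)
    (hb : MemLp b 2 volume) :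
    ∫ x, (k ⋆[ContinuousLinearMap.lsmul ℝ ℝ, volume] a) x * b x =
      ∫ t, k t * ∫ x, a (x - t) * b x := by
  have hint : Integrable (fun q : Plane × Plane => k q.2 * (a (q.1 - q.2) * b q.1))
      (volume.prod volume) := by
    have hm : AEStronglyMeasurable (fun q : Plane × Plane => k q.2 * (a (q.1 - q.2) * b q.1))
        (volume.prod volume) := by
      refine (hk.comp continuous_snd).aestronglyMeasurable.mul (AEStronglyMeasurable.mul ?_ ?_)
      · exact (ham.comp_measurable (measurable_fst.sub measurable_snd)).aestronglyMeasurable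
      · exact hb.1.comp_fst
    rw [integrable_prod_iff' hm]
    constructor
    · refine ae_of_all _ fun t => ?_
      have := ha.comp_measurePreserving (measurePreserving_sub_right volume t)
      exact (integrable_smul_of_memLp this hb).const_mul (k t)
    · have h1 : (fun t => ∫ x, ‖k t * (a (x - t) * b x)‖) =
          fun t => ‖k t‖ * ∫ x, ‖a (x - t)‖ * ‖b x‖ := by
        ext t
        simp only [norm_mul, integral_const_mul]
      rw [h1]
      refine Continuous.integrable_of_hasCompactSupport
        (hk.norm.mul (continuous_integral_translate_mul ha.norm hb.norm)) ?_
      exact hkc.norm.mul_right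
  calc _ = ∫ x, ∫ t, k t * (a (x - t) * b x) := by
        refine integral_congr_ae (ae_of_all _ fun x => ?_)
        simp only [convolution_def, ContinuousLinearMap.lsmul_apply, smul_eq_mul]
        rw [← integral_mul_const]
        simp only [mul_assoc]
    _ = ∫ t, ∫ x, k t * (a (x - t) * b x) := integral_integral_swap hint
    _ = _ := by simp only [integral_const_mul]

/-- By Fubini the pairing is a `k n`-weighted mean of a continuous function of the translation. Only
weak convergence is needed, and the kernels need not be centred at the origin. -/
theorem tendsto_integral_convolution_mul {k : ℕ → Plane → ℝ} {a b : Plane → ℝ}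
    (hk : ∀ n, Continuous (k n)) (hkc : ∀ n, HasCompactSupport (k n)) (hk0 : ∀ n x, 0 ≤ k n x)
    (hk1 : ∀ n, ∫ x, k n x = 1)
    (hks : Tendsto (fun n => Function.support (k n)) atTop (𝓝 0).smallSets)
    (ham : StronglyMeasurable a) (ha : MemLp a 2 volume) (hb : MemLp b 2 volume) :
    Tendsto (fun n => ∫ x, (k n ⋆[ContinuousLinearMap.lsmul ℝ ℝ, volume] a) x * b x) atTop
      (𝓝 (∫ x, a x * b x)) := by
  -- The sign flip turns the weighted mean into a convolution evaluated at `0`.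
  have hc := (continuous_integral_translate_mul ha hb).comp continuous_neg
  have ht : Tendsto (Function.uncurry fun (_ : ℕ) (h : Plane) => ∫ x, a (x - -h) * b x)
      (atTop ×ˢ 𝓝 0) (𝓝 (∫ x, a x * b x)) := by
    have := (hc.tendsto 0).comp (tendsto_snd (f := (atTop : Filter ℕ)) (g := 𝓝 (0 : Plane)))
    simpa [Function.comp_def, Function.uncurry_def] using this
  have := convolution_tendsto_right (μ := (volume : Measure Plane)) (k := fun _ => (0 : Plane))
    (Eventually.of_forall hk0) (Eventually.of_forall hk1) hks
    (Eventually.of_forall fun _ => hc.aestronglyMeasurable) ht tendsto_const_nhds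
  refine this.congr fun n => ?_
  rw [integral_convolution_mul (hk n) (hkc n) ham ha hb, convolution_def]
  simp

theorem fderiv_convolution_apply {k a : Plane → ℝ} (hk : ContDiff ℝ ∞ k)
    (hkc : HasCompactSupport k) (ha : LocallyIntegrable a volume) (x v : Plane) :
    fderiv ℝ (k ⋆[ContinuousLinearMap.lsmul ℝ ℝ, volume] a) x v =
      ∫ y, fderiv ℝ k (x - y) v * a y := by
  have hk1 : ContDiff ℝ 1 k := hk.of_le (by simp)
  rw [(hkc.hasFDerivAt_convolution_left (ContinuousLinearMap.lsmul ℝ ℝ) hk1 ha x).fderiv,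
    convolution_eq_swap]
  have hex := (hkc.fderiv ℝ).convolutionExists_left
    ((ContinuousLinearMap.lsmul ℝ ℝ).precompL Plane) (hk1.continuous_fderiv one_ne_zero) ha x
  rw [ContinuousLinearMap.integral_apply hex.integrable_swap]
  simp [ContinuousLinearMap.precompL_apply]

/-- Mollifying a field orthogonal to all test gradients gives a divergence-free field. -/
theorem sum_fderiv_convolution_eq_zero {w : Plane → Plane} (hw : Integrable w)
    (hdiv : ∀ φ : Plane → ℝ, IsTest univ φ → ∫ x, inner ℝ (w x) (gradient φ x) = 0)
    {k : Plane → ℝ} (hk : ContDiff ℝ ∞ k) (hkc : HasCompactSupport k) (x : Plane) :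
    ∑ i, fderiv ℝ (k ⋆[ContinuousLinearMap.lsmul ℝ ℝ, volume] fun y => w y i) x
      (EuclideanSpace.single i 1) = 0 := by
  have hwi : ∀ i, Integrable fun y => w y i := fun i =>
    (EuclideanSpace.proj (𝕜 := ℝ) i).integrable_comp hw
  -- Pairing `w` with the gradient of this reflected kernel gives minus the divergence of the
  -- mollified field at `x`.
  have hκ : IsTest univ fun y => k (x - y) :=
    ⟨hk.comp (contDiff_const.sub contDiff_id),
      hkc.comp_homeomorph (Homeomorph.subLeft x), subset_univ _⟩
  have hfd : ∀ y v, fderiv ℝ (fun y => k (x - y)) y v = -fderiv ℝ k (x - y) v := by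
    intro y v
    have h1 : HasFDerivAt (fun y : Plane => x - y) (-ContinuousLinearMap.id ℝ Plane) y :=
      (hasFDerivAt_id y).const_sub x
    have h2 := ((hk.differentiable (by simp) (x - y)).hasFDerivAt.comp y h1).fderiv
    rw [Function.comp_def] at h2
    rw [h2]
    simp
  have hint : ∀ i : Fin 2, Integrable fun y =>
      fderiv ℝ k (x - y) (EuclideanSpace.single i 1) * w y i := by
    intro i
    have hc : Continuous fun y => fderiv ℝ k (x - y) (EuclideanSpace.single i 1) :=
      ((hk.continuous_fderiv (by simp)).comp (by fun_prop)).clm_apply continuous_const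
    obtain ⟨C, hC⟩ := (hkc.fderiv ℝ).exists_bound_of_continuous (hk.continuous_fderiv (by simp))
    refine (hwi i).bdd_mul (c := C * ‖EuclideanSpace.single i (1 : ℝ)‖) hc.aestronglyMeasurable
      (ae_of_all _ fun y => ?_)
    exact (ContinuousLinearMap.le_opNorm _ _).trans (by gcongr; exact hC _)
  have := hdiv _ hκ
  simp only [fderiv_convolution_apply hk hkc (hwi _).locallyIntegrable]
  rw [← integral_finsetSum _ fun i _ => hint i, ← neg_eq_zero, ← integral_neg, ← this]
  refine integral_congr_ae (ae_of_all _ fun y => ?_)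
  simp only [PiLp.inner_apply, gradient_apply_eq_fderiv, hfd, ← Finset.sum_neg_distrib]
  simp

/-- With `W` the mollified field, this is `∫ W · ∇(χ q) = 0` over `D`. Each `χ * W i` is a test
function on `D`, so it may be tested against `q`; the product rule leaves only a term with the
divergence of `W`. -/
theorem integral_mollified_eq_zero {D : Set Plane} (hD : IsOpen D)
    {w : Plane → Plane} (hw : Integrable w)
    (hdiv : ∀ φ : Plane → ℝ, IsTest univ φ → ∫ x, inner ℝ (w x) (gradient φ x) = 0)
    {q : Plane → ℝ} {g : Plane → Plane} (hq : IsH1WithGradient D q g)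
    {χ k : Plane → ℝ} (hχ : IsTest univ χ) (hk : ContDiff ℝ ∞ k) (hkc : HasCompactSupport k)
    (hsupp : ∀ i, tsupport χ ∩
      tsupport (k ⋆[ContinuousLinearMap.lsmul ℝ ℝ, volume] fun y => w y i) ⊆ D) :
    ∑ i, ∫ x, (k ⋆[ContinuousLinearMap.lsmul ℝ ℝ, volume] fun y => w y i) x *
      D.indicator (fun x => χ x * g x i + q x * gradient χ x i) x = 0 := by
  have hwi : ∀ i, LocallyIntegrable fun y => w y i := fun i =>
    ((EuclideanSpace.proj (𝕜 := ℝ) i).integrable_comp hw).locallyIntegrable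
  set W : Fin 2 → Plane → ℝ :=
    fun i => k ⋆[ContinuousLinearMap.lsmul ℝ ℝ, volume] fun y => w y i with hWdef
  have hW : ∀ i, ContDiff ℝ ∞ (W i) := fun i => hkc.contDiff_convolution_left _ hk (hwi i)
  have hdivW : ∀ x, ∑ i, fderiv ℝ (W i) x (EuclideanSpace.single i 1) = 0 :=
    sum_fderiv_convolution_eq_zero hw hdiv hk hkc
  have hθ : ∀ i, IsTest D (χ * W i) := fun i =>
    ⟨hχ.smooth.mul (hW i), hχ.compact.mul_right,
      (subset_inter (tsupport_mul_subset_left) (tsupport_mul_subset_right)).trans (hsupp i)⟩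
  have hfd : ∀ i x, fderiv ℝ (χ * W i) x (EuclideanSpace.single i 1) =
      χ x * fderiv ℝ (W i) x (EuclideanSpace.single i 1) + W i x * gradient χ x i := by
    intro i x
    rw [fderiv_mul (hχ.smooth.differentiable (by simp) x) ((hW i).differentiable (by simp) x),
      gradient_apply_eq_fderiv]
    simp
  have hgi : ∀ i, MemLp (fun x => g x i) 2 (volume.restrict D) := fun i =>
    (EuclideanSpace.proj (𝕜 := ℝ) i).comp_memLp' hq.memLp_grad
  have i1 : ∀ i, Integrable (fun x => fderiv ℝ (χ * W i) x (EuclideanSpace.single i 1) • q x)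
      (volume.restrict D) := fun i =>
    integrable_smul_of_memLp ((hθ i).memLp_fderiv _) hq.memLp
  have i2 : ∀ i, Integrable (fun x => (χ * W i) x • g x i) (volume.restrict D) := fun i =>
    integrable_smul_of_memLp (hθ i).memLp (hgi i)
  have i3 : ∀ i, Integrable (fun x => χ x * fderiv ℝ (W i) x (EuclideanSpace.single i 1) * q x)
      (volume.restrict D) := fun i => by
    refine integrable_smul_of_memLp (Continuous.memLp_of_hasCompactSupport ?_ ?_) hq.memLp
    · exact hχ.smooth.continuous.mul
        (((hW i).continuous_fderiv (by simp)).clm_apply continuous_const)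
    · exact hχ.compact.mul_right
  have e : ∀ i, ∫ x, W i x * D.indicator (fun x => χ x * g x i + q x * gradient χ x i) x =
      -∫ x in D, χ x * fderiv ℝ (W i) x (EuclideanSpace.single i 1) * q x := by
    intro i
    have h1 := hq.weakDeriv i _ (hθ i)
    have h2 : ∀ x, W i x * D.indicator (fun x => χ x * g x i + q x * gradient χ x i) x =
        D.indicator (fun x => W i x * (χ x * g x i + q x * gradient χ x i)) x := fun x => by
      by_cases hx : x ∈ D <;> simp [hx]
    simp only [h2]
    rw [integral_indicator hD.measurableSet, ← integral_neg]
    calc _ = ∫ x in D, ((χ * W i) x • g x i +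
          fderiv ℝ (χ * W i) x (EuclideanSpace.single i 1) • q x -
          χ x * fderiv ℝ (W i) x (EuclideanSpace.single i 1) * q x) := by
          refine integral_congr_ae (ae_of_all _ fun x => ?_)
          simp only [hfd, Pi.mul_apply, smul_eq_mul]
          ring
      _ = _ := by
          rw [integral_sub (by exact (i2 i).add (i1 i)) (i3 i),
            integral_add (i2 i) (i1 i), h1, integral_neg]
          ring
  rw [Finset.sum_congr rfl fun i _ => e i, Finset.sum_neg_distrib,
    ← integral_finsetSum _ fun i _ => i3 i, neg_eq_zero]
  refine integral_eq_zero_of_ae (ae_of_all _ fun x => ?_)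
  simp only [← Finset.sum_mul, ← Finset.mul_sum, hdivW x, Pi.zero_apply, mul_zero, zero_mul]

theorem memLp_indicator_localized {D : Set Plane} (hD : IsOpen D) {q : Plane → ℝ}
    {g : Plane → Plane} (hq : IsH1WithGradient D q g) {χ : Plane → ℝ} (hχ : IsTest univ χ)
    (i : Fin 2) :
    MemLp (D.indicator fun x => χ x * g x i + q x * gradient χ x i) 2 volume := by
  rw [memLp_indicator_iff_restrict hD.measurableSet]
  have hgi : MemLp (fun x => g x i) 2 (volume.restrict D) :=
    (EuclideanSpace.proj (𝕜 := ℝ) i).comp_memLp' hq.memLp_grad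
  have m1 : MemLp χ ⊤ (volume.restrict D) :=
    hχ.smooth.continuous.memLp_of_hasCompactSupport hχ.compact
  have m2 : MemLp (fun x => gradient χ x i) ⊤ (volume.restrict D) := by
    simp only [gradient_apply_eq_fderiv]
    exact ((hχ.smooth.continuous_fderiv (by simp)).clm_apply
      continuous_const).memLp_of_hasCompactSupport (hχ.compact.fderiv_apply ℝ _)
  exact MemLp.add (hgi.mul m1) (m2.mul hq.memLp)

/-! ### Orthogonality to all gradients. -/

/-- Kernels centred at `t • e` with radius proportional to `t` move the support of `w` along the
cone, hence into `D` near `p`. The mollified identity then applies, and `t` tends to zero. -/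
theorem integral_localized_eq_zero {D : Set Plane} (hD : IsOpen D) (hb : Bornology.IsBounded D)
    {p e : Plane} {ρ : ℝ} (hρ : 0 < ρ)
    (hcone : ∀ x ∈ D, x ∈ Metric.ball p ρ → ∀ z : Plane, ‖z‖ < ρ →
      ∀ t ∈ Icc (0 : ℝ) 1, x + t • (e + z) ∈ D)
    {w : Plane → Plane} (hwm : StronglyMeasurable w) (hwL : MemLp w 2 volume)
    (hw0 : ∀ x ∉ D, w x = 0)
    (hdiv : ∀ φ : Plane → ℝ, IsTest univ φ → ∫ x, inner ℝ (w x) (gradient φ x) = 0)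
    {q : Plane → ℝ} {g : Plane → Plane} (hq : IsH1WithGradient D q g)
    {χ : Plane → ℝ} (hχ : ContDiff ℝ ∞ χ) (hχs : tsupport χ ⊆ Metric.ball p (ρ / 2)) :
    ∑ i, ∫ x, w x i * D.indicator (fun x => χ x * g x i + q x * gradient χ x i) x = 0 := by
  have hχt : IsTest univ χ := ⟨hχ, HasCompactSupport.of_support_subset_isCompact
    (isCompact_closedBall p (ρ / 2))
    ((subset_tsupport χ).trans (hχs.trans Metric.ball_subset_closedBall)), subset_univ _⟩
  have hwI : Integrable w := by
    refine (integrableOn_iff_integrable_of_support_subset (s := D) ?_).1 ?_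
    · intro x hx
      by_contra h
      exact hx (hw0 x h)
    · have : IsFiniteMeasure (volume.restrict D) := ⟨by simpa using hb.measure_lt_top⟩
      exact hwL.restrict D |>.integrable one_le_two
  have hwim : ∀ i, StronglyMeasurable fun y => w y i := fun i =>
    (EuclideanSpace.proj (𝕜 := ℝ) i).continuous.comp_stronglyMeasurable hwm
  have hwiL : ∀ i, MemLp (fun y => w y i) 2 volume := fun i =>
    (EuclideanSpace.proj (𝕜 := ℝ) i).comp_memLp' hwL
  have hbL := memLp_indicator_localized hD hq hχt
  -- bumps at scale `t`, centred at `t • e`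
  obtain ⟨T, hT0, hT1, hTρ⟩ : ∃ T : ℝ, 0 < T ∧ T ≤ 1 ∧ T * (‖e‖ + ρ) ≤ ρ / 2 := by
    refine ⟨min 1 (ρ / 2 / (‖e‖ + ρ)), by positivity, min_le_left _ _, ?_⟩
    rw [← le_div_iff₀ (by positivity)]
    exact min_le_right _ _
  let t : ℕ → ℝ := fun n => T / (n + 1)
  have ht0 : ∀ n, 0 < t n := fun n => by positivity
  have htT : ∀ n, t n ≤ T := fun n => div_le_self hT0.le (by linarith [n.cast_nonneg (α := ℝ)])
  have htlim : Tendsto t atTop (𝓝 0) := by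
    have := (tendsto_one_div_add_atTop_nhds_zero_nat (𝕜 := ℝ)).const_mul T
    simpa [t, div_eq_mul_inv] using this
  let β : ∀ n, ContDiffBump (t n • e) := fun n =>
    ⟨t n * (ρ / 4), t n * (ρ / 2), mul_pos (ht0 n) (by positivity),
      mul_lt_mul_of_pos_left (by linarith) (ht0 n)⟩
  let k : ℕ → Plane → ℝ := fun n => (β n).normed volume
  have hk : ∀ n, ContDiff ℝ ∞ (k n) := fun n => (β n).contDiff_normed
  have hkc : ∀ n, HasCompactSupport (k n) := fun n => (β n).hasCompactSupport_normed
  have hks : ∀ n, Function.support (k n) = Metric.ball (t n • e) (t n * (ρ / 2)) := fun n =>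
    (β n).support_normed_eq
  have hks0 : Tendsto (fun n => Function.support (k n)) atTop (𝓝 0).smallSets := by
    rw [(Metric.nhds_basis_ball (x := (0 : Plane))).smallSets.tendsto_right_iff]
    intro ε hε
    have h1 := htlim.mul_const (‖e‖ + ρ)
    rw [zero_mul] at h1
    filter_upwards [h1.eventually_lt_const hε] with n hn
    rw [hks n]
    intro x hx
    rw [Metric.mem_ball, dist_eq_norm] at hx
    rw [mem_ball_zero_iff]
    have h2 : ‖x‖ ≤ ‖x - t n • e‖ + ‖t n • e‖ := by
      simpa using norm_add_le (x - t n • e) (t n • e)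
    rw [norm_smul, Real.norm_of_nonneg (ht0 n).le] at h2
    nlinarith [mul_pos (ht0 n) hρ]
  have hsupp : ∀ n i, tsupport χ ∩
      tsupport (k n ⋆[ContinuousLinearMap.lsmul ℝ ℝ, volume] fun y => w y i) ⊆ D := by
    rintro n i x ⟨hx1, hx2⟩
    have hcl : tsupport (k n ⋆[ContinuousLinearMap.lsmul ℝ ℝ, volume] fun y => w y i) ⊆
        Metric.closedBall (t n • e) (t n * (ρ / 2)) + closure D := by
      refine closure_minimal ((support_convolution_subset _).trans (add_subset_add ?_ ?_))
        ((isCompact_closedBall _ _).add hb.isCompact_closure).isClosed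
      · rw [hks n]; exact Metric.ball_subset_closedBall
      · intro y hy
        refine subset_closure ?_
        by_contra h
        exact hy (by simp [hw0 y h])
    obtain ⟨s, hs, y, hy, rfl⟩ := hcl hx2
    change s + y ∈ D
    have hxp := hχs hx1
    rw [Metric.mem_closedBall, dist_eq_norm] at hs
    simp only [Metric.mem_ball, dist_eq_norm] at hxp
    have htn := ht0 n
    -- The cone property starts from points of `D`, so `y` is replaced by a nearby `y'`; the kernel
    -- radius and this error are each at most `t n * (ρ / 2)`.
    obtain ⟨y', hy'D, hy'⟩ := Metric.mem_closure_iff.1 hy (t n * (ρ / 2)) (by positivity)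
    rw [dist_eq_norm] at hy'
    have hkey : ‖(s - t n • e) + (y - y')‖ < t n * ρ := by
      linarith [norm_add_le (s - t n • e) (y - y')]
    have h1 : s + y = y' + t n • (e + (t n)⁻¹ • ((s - t n • e) + (y - y'))) := by
      rw [smul_add, smul_inv_smul₀ htn.ne']; abel
    rw [h1]
    refine hcone y' hy'D ?_ _ ?_ (t n) ⟨htn.le, (htT n).trans hT1⟩
    · rw [Metric.mem_ball, dist_eq_norm]
      have h2 : y' - p = (s + y - p) - ((s - t n • e) + (y - y')) - t n • e := by abel
      rw [h2]
      have h3 : ‖t n • e‖ = t n * ‖e‖ := by rw [norm_smul, Real.norm_of_nonneg htn.le]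
      have h4 : t n * (‖e‖ + ρ) ≤ ρ / 2 :=
        (mul_le_mul_of_nonneg_right (htT n) (by positivity)).trans hTρ
      linarith [norm_sub_le ((s + y - p) - ((s - t n • e) + (y - y'))) (t n • e),
        norm_sub_le (s + y - p) ((s - t n • e) + (y - y'))]
    · rw [norm_smul, norm_inv, Real.norm_of_nonneg htn.le, inv_mul_lt_iff₀ htn]
      exact hkey
  have hlim := tendsto_finsetSum (Finset.univ : Finset (Fin 2)) fun i _ =>
    tendsto_integral_convolution_mul (fun n => (hk n).continuous) hkc
      (fun n => (β n).nonneg_normed) (fun n => (β n).integral_normed) hks0 (hwim i) (hwiL i)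
      (hbL i)
  refine tendsto_nhds_unique hlim (tendsto_const_nhds.congr fun n => ?_)
  exact (integral_mollified_eq_zero hD hwI hdiv hq hχt (hk n) (hkc n) (hsupp n)).symm

theorem exists_smooth_partition {D : Set Plane} (hD : IsOpen D) (hb : Bornology.IsBounded D)
    (hs : HasSmoothBoundary D) :
    ∃ (ι : Type) (_ : Fintype ι) (p e : ι → Plane) (ρ : ι → ℝ) (χ : ι → Plane → ℝ),
      (∀ i, 0 < ρ i) ∧
      (∀ i, ∀ x ∈ D, x ∈ Metric.ball (p i) (ρ i) → ∀ z : Plane, ‖z‖ < ρ i →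
        ∀ t ∈ Icc (0 : ℝ) 1, x + t • (e i + z) ∈ D) ∧
      (∀ i, ContDiff ℝ ∞ (χ i)) ∧ (∀ i, tsupport (χ i) ⊆ Metric.ball (p i) (ρ i / 2)) ∧
      ∀ x ∈ D, ∑ i, χ i x = 1 := by
  choose ρ hρ e he using fun p : closure D => hs.exists_cone hD p.2
  obtain ⟨t, ht⟩ := hb.isCompact_closure.elim_nhds_subcover'
    (fun p hp => Metric.ball p (ρ ⟨p, hp⟩ / 2))
    (fun p hp => Metric.ball_mem_nhds p (half_pos (hρ ⟨p, hp⟩)))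
  obtain ⟨f, hf⟩ := SmoothPartitionOfUnity.exists_isSubordinate (modelWithCornersSelf ℝ Plane)
    (isClosed_closure (s := D)) (fun i : t => Metric.ball (i.1 : Plane) (ρ i.1 / 2))
    (fun i => Metric.isOpen_ball) (fun x hx => by
      obtain ⟨i, hi, hxi⟩ := mem_iUnion₂.1 (ht hx)
      exact mem_iUnion.2 ⟨⟨i, hi⟩, hxi⟩)
  refine ⟨t, inferInstance, fun i => i.1, fun i => e i.1, fun i => ρ i.1, fun i => f i,
    fun i => hρ i.1, fun i => he i.1, fun i => (f i).contMDiff.contDiff, fun i => hf i,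
    fun x hx => ?_⟩
  have := f.sum_eq_one (subset_closure hx)
  rwa [finsum_eq_sum_of_fintype] at this

/-- A square integrable field on `D` orthogonal to the gradients of test functions on the plane is
orthogonal to the gradients of all `H¹(D)` functions. -/
theorem integral_inner_eq_zero_of_isH1WithGradient {D : Set Plane} (hD : IsOpen D)
    (hb : Bornology.IsBounded D) (hs : HasSmoothBoundary D) {w : Plane → Plane}
    (hwm : StronglyMeasurable w) (hwL : MemLp w 2 volume) (hw0 : ∀ x ∉ D, w x = 0)
    (hdiv : ∀ φ : Plane → ℝ, IsTest univ φ → ∫ x, inner ℝ (w x) (gradient φ x) = 0)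
    {q : Plane → ℝ} {g : Plane → Plane} (hq : IsH1WithGradient D q g) :
    ∫ x in D, inner ℝ (w x) (g x) = 0 := by
  obtain ⟨ι, _, p, e, ρ, χ, hρ, hcone, hχ, hχs, hχ1⟩ := exists_smooth_partition hD hb hs
  have hχt : ∀ i, IsTest univ (χ i) := fun i =>
    ⟨hχ i, HasCompactSupport.of_support_subset_isCompact (isCompact_closedBall (p i) (ρ i / 2))
      ((subset_tsupport _).trans ((hχs i).trans Metric.ball_subset_closedBall)), subset_univ _⟩
  have hwiL : ∀ j, MemLp (fun y => w y j) 2 volume := fun j =>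
    (EuclideanSpace.proj (𝕜 := ℝ) j).comp_memLp' hwL
  have hint : ∀ i j, Integrable fun x => w x j *
      D.indicator (fun x => χ i x * g x j + q x * gradient (χ i) x j) x := fun i j =>
    integrable_smul_of_memLp (hwiL j) (memLp_indicator_localized hD hq (hχt i) j)
  -- The cutoffs sum to `1` on the open set `D`, so the terms `q ∇χ` cancel in the sum.
  have hgrad : ∀ x ∈ D, ∀ j, ∑ i, gradient (χ i) x j = 0 := by
    intro x hx j
    simp only [gradient_apply_eq_fderiv]
    rw [← sum_apply,
      ← fderiv_fun_sum fun i _ => (hχ i).differentiable (by simp) x]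
    have : (fun y => ∑ i, χ i y) =ᶠ[𝓝 x] fun _ => 1 := by
      filter_upwards [hD.mem_nhds hx] with y hy using hχ1 y hy
    rw [this.fderiv_eq]
    simp
  have hsum : ∀ x, D.indicator (fun x => inner ℝ (w x) (g x)) x = ∑ i, ∑ j, w x j *
      D.indicator (fun x => χ i x * g x j + q x * gradient (χ i) x j) x := by
    intro x
    by_cases hx : x ∈ D
    · simp only [indicator_of_mem hx]
      rw [Finset.sum_comm, PiLp.inner_apply]
      refine Finset.sum_congr rfl fun j _ => ?_
      rw [← Finset.mul_sum, Finset.sum_add_distrib, ← Finset.sum_mul, ← Finset.mul_sum,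
        hχ1 x hx, hgrad x hx j]
      simp [mul_comm]
    · simp [hx]
  rw [← integral_indicator hD.measurableSet]
  simp only [hsum]
  rw [integral_finsetSum _ fun i _ => integrable_finsetSum _ fun j _ => hint i j]
  refine Finset.sum_eq_zero fun i _ => ?_
  rw [integral_finsetSum _ fun j _ => hint i j]
  exact integral_localized_eq_zero hD hb (hρ i) (hcone i) hwm hwL hw0 hdiv hq (hχ i) (hχs i)

/-! ### The closure of the test gradients. -/

/-- The restrictions to `D` of gradients of test functions on the plane. -/
def testGradients (D : Set Plane) : Submodule ℝ (Lp Plane 2 (volume.restrict D)) where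
  carrier := {u | ∃ φ, IsTest univ φ ∧ u =ᵐ[volume.restrict D] gradient φ}
  zero_mem' := by
    refine ⟨0, ⟨contDiff_const, HasCompactSupport.zero, subset_univ _⟩, ?_⟩
    filter_upwards [Lp.coeFn_zero Plane 2 (volume.restrict D)] with x hx
    rw [hx, gradient, fderiv_zero]
    simp
  add_mem' := by
    rintro u v ⟨φ, hφ, hu⟩ ⟨θ, hθ, hv⟩
    refine ⟨φ + θ, ⟨hφ.smooth.add hθ.smooth, hφ.compact.add hθ.compact, subset_univ _⟩, ?_⟩
    filter_upwards [Lp.coeFn_add u v, hu, hv] with x h1 h2 h3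
    rw [h1, Pi.add_apply, h2, h3, gradient, gradient, gradient,
      fderiv_add (hφ.smooth.differentiable (by simp) x) (hθ.smooth.differentiable (by simp) x),
      map_add]
  smul_mem' := by
    rintro c u ⟨φ, hφ, hu⟩
    refine ⟨c • φ, ⟨hφ.smooth.const_smul c, hφ.compact.smul_left (f := fun _ => c),
      subset_univ _⟩, ?_⟩
    filter_upwards [Lp.coeFn_smul c u, hu] with x h1 h2
    rw [h1, Pi.smul_apply, h2, gradient, gradient,
      fderiv_const_smul (hφ.smooth.differentiable (by simp) x)]
    simp

theorem IsTest.toLp_mem_testGradients {D : Set Plane} {φ : Plane → ℝ} (hφ : IsTest univ φ) :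
    (hφ.memLp_gradient (μ := volume.restrict D)).toLp (gradient φ) ∈ testGradients D :=
  ⟨φ, hφ, MemLp.coeFn_toLp _⟩

/-- The forward direction is the Poincaré argument. The converse uses that the closure is the double
orthogonal complement, with the mollification argument applied to an orthogonal field extended by
zero. -/
theorem mem_closure_testGradients_iff {D : Set Plane} (hD : IsOpen D)
    (hb : Bornology.IsBounded D) (hs : HasSmoothBoundary D)
    (u : Lp Plane 2 (volume.restrict D)) :
    u ∈ (testGradients D).topologicalClosure ↔ ∃ q, IsH1WithGradient D q u := by
  constructor
  · intro hu
    obtain ⟨a, ha, hau⟩ := mem_closure_iff_seq_limit.1 hu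
    choose φ hφ haφ using ha
    refine exists_isH1WithGradient_of_tendsto hD hb hs hφ (Lp.memLp u) ?_
    refine ((Lp.tendsto_Lp_iff_tendsto_eLpNorm' _ _).1 hau).congr fun n => eLpNorm_congr_ae ?_
    filter_upwards [haφ n] with x hx
    simp [hx]
  · rintro ⟨q, hq⟩
    rw [← Submodule.orthogonal_orthogonal_eq_closure, Submodule.mem_orthogonal]
    intro v hv
    have hsm : StronglyMeasurable (D.indicator v) :=
      (Lp.stronglyMeasurable v).indicator hD.measurableSet
    have hL : MemLp (D.indicator v) 2 volume :=
      (memLp_indicator_iff_restrict hD.measurableSet).2 (Lp.memLp v)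
    have hdiv : ∀ φ : Plane → ℝ, IsTest univ φ →
        ∫ x, inner ℝ (D.indicator v x) (gradient φ x) = 0 := by
      intro φ hφ
      have h1 := Submodule.inner_left_of_mem_orthogonal
        (hφ.toLp_mem_testGradients (D := D)) hv
      rw [L2.inner_def] at h1
      rw [← h1, ← integral_indicator hD.measurableSet]
      have h2 : ∀ᵐ x, x ∈ D → (hφ.memLp_gradient (μ := volume.restrict D)).toLp _ x =
          gradient φ x := (ae_restrict_iff' hD.measurableSet).1 (MemLp.coeFn_toLp _)
      refine integral_congr_ae ?_
      filter_upwards [h2] with x hx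
      by_cases hxD : x ∈ D
      · simp [hxD, hx hxD]
      · simp [hxD]
    have := integral_inner_eq_zero_of_isH1WithGradient hD hb hs hsm hL
      (fun x hx => indicator_of_notMem hx _) hdiv hq
    rw [L2.inner_def, ← this]
    exact setIntegral_congr_fun hD.measurableSet fun x hx => by simp [hx]

/-! ### Extension from `D` to the cylinder. -/

theorem memLp_comp_fst_cylinder {D : Set Plane} (h : ℝ) {u : Plane → Plane}
    (hu : MemLp u 2 (volume.restrict D)) :
    MemLp (fun p : Plane × ℝ => u p.1) 2
      ((volume : Measure (Plane × ℝ)).restrict (cylinder D h)) := by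
  rw [restrict_cylinder]
  exact hu.comp_fst _

theorem ae_cylinder_of_ae {D : Set Plane} {h : ℝ} {P : Plane → Prop}
    (hP : ∀ᵐ x ∂(volume.restrict D), P x) :
    ∀ᵐ p ∂((volume : Measure (Plane × ℝ)).restrict (cylinder D h)), P p.1 := by
  rw [restrict_cylinder]
  exact Measure.quasiMeasurePreserving_fst.ae hP

theorem eLpNorm_comp_fst_cylinder {D : Set Plane} {h : ℝ} {u : Plane → Plane}
    (hu : AEStronglyMeasurable u (volume.restrict D)) :
    eLpNorm (fun p : Plane × ℝ => u p.1) 2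
      ((volume : Measure (Plane × ℝ)).restrict (cylinder D h)) =
      ENNReal.ofReal h ^ (1 / 2 : ℝ) * eLpNorm u 2 (volume.restrict D) := by
  have hm : Measure.map Prod.fst ((volume.restrict D).prod (volume.restrict (Ioo (-h) 0))) =
      ENNReal.ofReal h • volume.restrict D := by
    rw [Measure.map_fst_prod]; simp
  have h1 := eLpNorm_map_measure (f := Prod.fst) (p := 2) (g := u)
    (μ := (volume.restrict D).prod (volume.restrict (Ioo (-h) 0)))
    (by rw [hm]; exact hu.smul_measure _) measurable_fst.aemeasurable
  rw [hm, eLpNorm_smul_measure_of_ne_top (by simp)] at h1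
  rw [restrict_cylinder]
  simpa [Function.comp_def] using h1.symm

/-- The extension of a horizontal field on `D` to a `z`-independent field on the cylinder. -/
noncomputable def constantInZ (D : Set Plane) (h : ℝ) :
    Lp Plane 2 (volume.restrict D) →ₗ[ℝ] L2Field D h where
  toFun u := (memLp_comp_fst_cylinder h (Lp.memLp u)).toLp _
  map_add' u v := by
    rw [← MemLp.toLp_add]
    refine MemLp.toLp_congr _ _ ?_
    filter_upwards [ae_cylinder_of_ae (h := h) (Lp.coeFn_add u v)] with p hp
    exact hp
  map_smul' c u := by
    rw [RingHom.id_apply, ← MemLp.toLp_const_smul]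
    refine MemLp.toLp_congr _ _ ?_
    filter_upwards [ae_cylinder_of_ae (h := h) (Lp.coeFn_smul c u)] with p hp
    exact hp

theorem coeFn_constantInZ {D : Set Plane} {h : ℝ} (u : Lp Plane 2 (volume.restrict D)) :
    constantInZ D h u =ᵐ[(volume : Measure (Plane × ℝ)).restrict (cylinder D h)]
      fun p => u p.1 :=
  (memLp_comp_fst_cylinder h (Lp.memLp u)).coeFn_toLp

theorem norm_constantInZ {D : Set Plane} {h : ℝ} (hh : 0 < h)
    (u : Lp Plane 2 (volume.restrict D)) : ‖constantInZ D h u‖ = √h * ‖u‖ := by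
  rw [constantInZ, LinearMap.coe_mk, AddHom.coe_mk, Lp.norm_toLp, Lp.norm_def,
    eLpNorm_comp_fst_cylinder (Lp.memLp u).1, ENNReal.toReal_mul, ← ENNReal.toReal_rpow,
    ENNReal.toReal_ofReal hh.le, Real.sqrt_eq_rpow]

theorem continuous_constantInZ {D : Set Plane} {h : ℝ} (hh : 0 < h) :
    Continuous (constantInZ D h) :=
  AddMonoidHomClass.continuous_of_bound _ (√h) fun u => (norm_constantInZ hh u).le

theorem isClosedEmbedding_constantInZ {D : Set Plane} {h : ℝ} (hh : 0 < h) :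
    IsClosedEmbedding (constantInZ D h) := by
  refine AntilipschitzWith.isClosedEmbedding (K := Real.toNNReal (√h)⁻¹)
    (AddMonoidHomClass.antilipschitz_of_bound _ fun u => ?_)
    (AddMonoidHomClass.lipschitz_of_bound _ (√h) fun u =>
      (norm_constantInZ hh u).le).uniformContinuous
  rw [norm_constantInZ hh, Real.coe_toNNReal _ (by positivity),
    inv_mul_cancel_left₀ (Real.sqrt_pos.2 hh).ne']

/-- On each vertical fibre `∂_z φ` integrates to zero, since `φ` vanishes at both ends. -/
theorem hasWeakDeriv_z_zero {D : Set Plane} (hD : MeasurableSet D) {h : ℝ} {g : Plane → Plane}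
    (hg : MemLp g 2 (volume.restrict D)) :
    HasWeakDeriv (cylinder D h) ((0, 1) : Plane × ℝ) (fun p => g p.1) 0 := by
  intro φ hφ
  have hi := integrable_smul_of_memLp (hφ.memLp_fderiv ((0, 1) : Plane × ℝ))
    (memLp_comp_fst_cylinder h hg)
  rw [restrict_cylinder] at hi ⊢
  simp only [Pi.zero_apply, smul_zero, integral_zero, neg_zero]
  rw [integral_prod _ hi]
  refine integral_eq_zero_of_ae ((ae_restrict_iff' hD).2 (ae_of_all _ fun x _ => ?_))
  simp only [Pi.zero_apply]
  rw [integral_smul_const]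
  have hsup : ∀ z, z ∉ Ioo (-h) 0 → (x, z) ∉ tsupport φ := fun z hz hm => hz (hφ.supp hm).2
  have hd : ∀ z, HasDerivAt (fun z => φ (x, z)) (fderiv ℝ φ (x, z) (0, 1)) z := by
    intro z
    have h1 : HasDerivAt (fun z : ℝ => (x, z)) ((0, 1) : Plane × ℝ) z :=
      (hasDerivAt_const z x).prodMk (hasDerivAt_id z)
    exact ((hφ.smooth.differentiable (by simp)).differentiableAt.hasFDerivAt).comp_hasDerivAt z h1
  have hz : ∀ z, z ∉ Ioo (-h) 0 → fderiv ℝ φ (x, z) (0, 1) = 0 := by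
    intro z hz
    rw [image_eq_zero_of_notMem_tsupport (f := fderiv ℝ φ)
      fun hm => hsup z hz (tsupport_fderiv_subset ℝ hm)]
    rfl
  have hc : Continuous fun z => fderiv ℝ φ (x, z) (0, 1) :=
    ((hφ.smooth.continuous_fderiv (by simp)).comp (by fun_prop)).clm_apply continuous_const
  have : ∫ z in Ioo (-h) 0, fderiv ℝ φ (x, z) (0, 1) = 0 := by
    rcases le_total h 0 with h0 | h0
    · simp [Ioo_eq_empty (show ¬ -h < 0 by linarith)]
    rw [← integral_Ioc_eq_integral_Ioo, ← intervalIntegral.integral_of_le (by linarith),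
      intervalIntegral.integral_eq_sub_of_hasDerivAt (fun z _ => hd z) (hc.intervalIntegrable _ _),
      image_eq_zero_of_notMem_tsupport (hsup 0 (by simp)),
      image_eq_zero_of_notMem_tsupport (hsup (-h) (by simp)), sub_zero]
  rw [this, zero_smul]

/-! ### The orthogonal decomposition on the cylinder. -/

/-- The condition `u_z = 0` is automatic for a field depending on the horizontal variable alone, so
only the description of gradients on `D` matters. -/
theorem G_eq_map {D : Set Plane} (hD : IsOpen D) (hb : Bornology.IsBounded D)
    (hs : HasSmoothBoundary D) (h : ℝ) :
    G D h = (testGradients D).topologicalClosure.map (constantInZ D h) := by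
  ext u
  rw [Submodule.mem_map]
  constructor
  · rintro ⟨-, q, g, hq, hug⟩
    have hgae := hq.memLp_grad.coeFn_toLp
    refine ⟨hq.memLp_grad.toLp g, (mem_closure_testGradients_iff hD hb hs _).2 ⟨q, hq.memLp,
      Lp.memLp _, fun i φ hφ => ?_⟩, Lp.ext ?_⟩
    · rw [hq.weakDeriv i φ hφ]
      congr 1
      refine integral_congr_ae ?_
      filter_upwards [hgae] with x hx
      rw [hx]
    · filter_upwards [coeFn_constantInZ (h := h) (hq.memLp_grad.toLp g), hug,
        ae_cylinder_of_ae (h := h) hgae] with p h1 h2 h3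
      rw [h1, h2, h3]
  · rintro ⟨v, hv, rfl⟩
    obtain ⟨q, hq⟩ := (mem_closure_testGradients_iff hD hb hs v).1 hv
    exact ⟨(hasWeakDeriv_z_zero hD.measurableSet (Lp.memLp v)).congr (coeFn_constantInZ v).symm,
      q, v, hq, coeFn_constantInZ v⟩

theorem mem_H1_iff_inner_eq_zero {D : Set Plane} {h : ℝ} (hh : 0 < h) (v : L2Field D h) :
    v ∈ H1 D h hh ↔ ∀ u ∈ testGradients D, inner ℝ (constantInZ D h u) v = 0 := by
  have key : ∀ (φ : Plane → ℝ) (u : Lp Plane 2 (volume.restrict D)),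
      u =ᵐ[volume.restrict D] gradient φ →
      inner ℝ (constantInZ D h u) v = ∫ p in cylinder D h, inner ℝ (v p) (gradient φ p.1) := by
    intro φ u hu
    rw [L2.inner_def]
    refine integral_congr_ae ?_
    filter_upwards [coeFn_constantInZ (h := h) u, ae_cylinder_of_ae (h := h) hu] with p h1 h2
    rw [h1, h2, real_inner_comm]
  refine (memH1_iff hh v).trans ⟨?_, fun hv φ hφ => ?_⟩
  · rintro hv u ⟨φ, hφ, hu⟩
    rw [key φ u hu, hv φ hφ]
  · rw [← key φ _ hφ.memLp_gradient.coeFn_toLp, hv _ hφ.toLp_mem_testGradients]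

/-- Orthogonality to the extended test gradients passes to the closure by continuity of the
extension. -/
theorem H1_eq_orthogonal_G {D : Set Plane} (hD : IsOpen D) (hb : Bornology.IsBounded D)
    (hs : HasSmoothBoundary D) {h : ℝ} (hh : 0 < h) : H1 D h hh = (G D h)ᗮ := by
  ext v
  rw [mem_H1_iff_inner_eq_zero, G_eq_map hD hb hs, Submodule.mem_orthogonal]
  constructor
  · rintro hv _ ⟨u, hu, rfl⟩
    have hcl : IsClosed {u | inner ℝ (constantInZ D h u) v = 0} :=
      isClosed_eq ((continuous_constantInZ hh).inner continuous_const) continuous_const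
    exact closure_minimal (fun u hu => hv u hu) hcl hu
  · intro hv u hu
    exact hv _ ⟨u, Submodule.le_topologicalClosure _ hu, rfl⟩

theorem isClosed_G {D : Set Plane} (hD : IsOpen D) (hb : Bornology.IsBounded D)
    (hs : HasSmoothBoundary D) {h : ℝ} (hh : 0 < h) : IsClosed (G D h : Set (L2Field D h)) := by
  rw [G_eq_map hD hb hs, Submodule.map_coe]
  exact (isClosedEmbedding_constantInZ hh).isClosedMap _
    (Submodule.isClosed_topologicalClosure _)

end HydrostaticHelmholtz

theorem theorem3p1 (D : Set HydrostaticHelmholtz.Plane) (hD : IsOpen D)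
    (hbdd : Bornology.IsBounded D) (hsmooth : HydrostaticHelmholtz.HasSmoothBoundary D)
    (h : ℝ) (hh : 0 < h) :
    IsClosed (HydrostaticHelmholtz.H1 D h hh : Set (HydrostaticHelmholtz.L2Field D h)) ∧
    HydrostaticHelmholtz.H1 D h hh ⟂ HydrostaticHelmholtz.G D h ∧
    IsCompl (HydrostaticHelmholtz.H1 D h hh) (HydrostaticHelmholtz.G D h) ∧
    ∃ P : HydrostaticHelmholtz.L2Field D h →L[ℝ] HydrostaticHelmholtz.L2Field D h,
      HydrostaticHelmholtz.IsLerayProjector D h hh P ∧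
      P.ker = HydrostaticHelmholtz.G D h ∧
      ∀ Q : HydrostaticHelmholtz.L2Field D h →L[ℝ] HydrostaticHelmholtz.L2Field D h,
        HydrostaticHelmholtz.IsLerayProjector D h hh Q → Q = P := by
  have hH := HydrostaticHelmholtz.H1_eq_orthogonal_G hD hbdd hsmooth hh
  have : CompleteSpace (HydrostaticHelmholtz.G D h) :=
    (HydrostaticHelmholtz.isClosed_G hD hbdd hsmooth hh).completeSpace_coe
  have hP : IsStarProjection (HydrostaticHelmholtz.G D h)ᗮ.starProjection :=
    isStarProjection_starProjection
  refine ⟨?_, ?_, ?_, (HydrostaticHelmholtz.G D h)ᗮ.starProjection,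
    ⟨hP.isIdempotentElem, hP.isSelfAdjoint, ?_⟩, ?_, ?_⟩
  · rw [hH]
    exact Submodule.isClosed_orthogonal _
  · rw [hH]
    exact (Submodule.isOrtho_orthogonal_right _).symm
  · rw [hH]
    exact (Submodule.isCompl_orthogonal _).symm
  · rw [hH, Submodule.range_starProjection]
  · rw [Submodule.ker_starProjection, Submodule.orthogonal_orthogonal]
  -- A self-adjoint idempotent is determined by its range.
  · rintro Q ⟨hQi, hQs, hQr⟩
    refine ContinuousLinearMap.IsStarProjection.ext ⟨hQi, hQs⟩ hP ?_
    rw [hQr, hH, Submodule.range_starProjection]
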